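/- Let $\mathcal Y=\mathbb R^m$ carry an arbitrary norm $\|\cdot\|$, with dual norm $\|\cdot\|_*$. Let $\widehat y_1,\dots,\widehat y_N\in\mathcal Y$, let $\mathcal A\subseteq\mathbb R^m$ be any set of decisions, and let $\mathcal V$ be a convex set of pairs $(p,\delta)$, where $p=(p_1,\dots,p_N)$ is a probability vector and $\delta\in\mathbb R$. Put $\mathcal V_+=\{(p,\delta)\in\mathcal V:\delta\ge 0\}$ and let $\sigma^*(v\mid\mathcal V_+)=\sup_{(p,\delta)\in\mathcal V_+}\big(\sum_{i=1}^N v_ip_i+v_{N+1}\delta\big)$ be its support function, $v\in\mathbb R^{N+1}$. For a ground cost $\mathbb D$ on $\mathcal Y$ let $\mathcal W(\mathbb Q,\mathbb P)=\inf_\pi\mathbb E_\pi[\mathbb D(Y_1,Y_2)]$, over the couplings $\pi$ of $\mathbb Q$ and $\mathbb P$, be the optimal transport cost, and let $\mathbb B_\delta(\mathbb P)=\{\mathbb Q:\mathcal W(\mathbb Q,\mathbb P)\le\delta\}$ be the ball of probability measures (empty if $\delta<0$). For a loss $\ell(z,t)$ with $z\in\mathbb R$, $t\in\mathbb R^k$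 let $\rho_{\mathbb Q}(Y^\top\alpha)=\inf_{t\in\mathbb R^k}\mathbb E_{\mathbb Q}[\ell(Y^\top\alpha,t)]$. The union-ball problem is $$\inf_{\alpha\in\mathcal A}\ \sup_{\mathbb Q\in\bigcup_{(p,\delta)\in\mathcal V}\mathbb B_\delta(\sum_i p_i\mathrm I_{\widehat y_i})}\rho_{\mathbb Q}(Y^\top\alpha).\qquad(\mathrm P)$$ Here $\mathrm I_y$ is the point mass at $y$. Optimal values are taken in $[-\infty,\infty]$. A minimization problem is called a convex program if its feasible set is convex and its objective is a convex (extended-real-valued) function on that set. **(i)** Let $\mathbb D(y_1,y_2)=\|y_1-y_2\|$. Suppose that $\ell:\mathbb R\times\mathbb R^k\to\mathbb R$ is jointly convex in $(z,t)$, that for every $z$ all sublevel sets of $\ell(z,\cdot)$ are bounded, and that the functions $\ell(\cdot,t)$ are Lipschitz with a constant that does not depend on $t$; let $\operatorname{Lip}(\ell)$ be the smallest such constant. Then all expectations in (P) are finite, and (P) is equivalent to $$\inf_{\alpha\in\mathcal A,\ t\in\mathbb R^k}\ \sup_{(p,\delta)\in\mathcal V_+}\ \sum_{i=1}^N p_i\,\ell(\widehat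 y_i^\top\alpha,t)+\operatorname{Lip}(\ell)\,\delta\,\|\alpha\|_*:$$ the optimal values agree, and for every fixed $\alpha$ the objective of (P) is the infimum over $t$ of the inner supremum here. The optimal value of (P) is also that of $$\inf_{\alpha\in\mathcal A,\ t\in\mathbb R^k,\ v\in\mathbb R^{N+1}}\sigma^*(v\mid\mathcal V_+)\quad\text{s.t.}\quad v_i\ge\ell(\widehat y_i^\top\alpha,t)\ (i=1,\dots,N),\quad v_{N+1}\ge\operatorname{Lip}(\ell)\|\alpha\|_*.$$ If $\mathcal A$ is convex, both reformulations are convex programs. **(ii)** Let $q\in(1,\infty)$, $\mathbb D(y_1,y_2)=\|y_1-y_2\|^q$, $k=1$, $C>0$ and $\ell(z,t)=(C\,\bar\ell(z-t))^q$, where either $\bar\ell(x)=(|x-b_1|-b_2)_+$ with $b_1\in\mathbb R$, $b_2\ge0$, or $\bar\ell(x)=|x-b_1|+b_2$ with $b_1\in\mathbb R$, $b_2>0$. Then all expectations in (P) are finite, and (P) is equivalent, in the sense of (i), to $$\inf_{\alpha\in\mathcal A,\ t\in\mathbb R}\ \sup_{(p,\delta)\in\mathcal V_+}\Big[\Big(\sum_{i=1}^N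 p_i\,\ell(\widehat y_i^\top\alpha,t)\Big)^{1/q}+C\,\delta^{1/q}\|\alpha\|_*\Big]^q,$$ which is a convex program if $\mathcal A$ is convex. If moreover $\mathcal V_+\ne\emptyset$, the optimal value of (P) is also that of $$\inf_{\alpha\in\mathcal A,\ t\in\mathbb R,\ s\ge0,\ v\in\mathbb R^{N+1}}\Big[\sigma^*(v\mid\mathcal V_+)+C_q^1\,s+C_q\,v_{N+1}\Big\|\frac{\alpha}{v_{N+1}}\Big\|_*^{\frac q{q-1}}\Big]^q\quad\text{s.t.}\quad v_i\ge\frac{\ell(\widehat y_i^\top\alpha,t)}{s^{q-1}}\ (i=1,\dots,N),\quad v_{N+1}\ge0,$$ where $C_q^1=q^{\frac1{1-q}}-q^{\frac q{1-q}}$ and $C_q=C^{\frac q{q-1}}\big(q^{\frac1{1-q}}-q^{\frac q{1-q}}\big)$, and this is a convex program if $\mathcal A$ is convex. Here $a/0=\infty$ for $a>0$, $0/0=0$, and $v_{N+1}\|\alpha/v_{N+1}\|_*^{q/(q-1)}$ at $v_{N+1}=0$ is $\infty$ for $\alpha\ne0$ and $0$ for $\alpha=0$. -/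

import Mathlib

open MeasureTheory Set
open scoped NNReal ENNReal

namespace UnionBall

/-! ### Optimal transport, balls and the union-ball ambiguity set -/

section Transport

variable {E : Type*} [MeasurableSpace E]

/-- The couplings of `μ` and `ν`. -/
def couplings (μ ν : Measure E) : Set (Measure (E × E)) :=
  {π | π.map Prod.fst = μ ∧ π.map Prod.snd = ν}

/-- The optimal transport cost between `μ` and `ν` for the ground cost `D`. -/
noncomputable def otCost (D : E → E → ℝ) (μ ν : Measure E) : ℝ≥0∞ :=
  ⨅ π ∈ couplings μ ν, ∫⁻ z, ENNReal.ofReal (D z.1 z.2) ∂π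

/-- The optimal transport ball of radius `δ` around `P`. The comparison takes place in the extended
reals, so that the ball is empty when `δ < 0`. -/
def otBall (D : E → E → ℝ) (δ : ℝ) (P : Measure E) : Set (Measure E) :=
  {Q | IsProbabilityMeasure Q ∧ ((otCost D Q P : ℝ≥0∞) : EReal) ≤ (δ : EReal)}

/-- The discrete distribution with mass `p i` at the point `y i`. -/
noncomputable def discreteLaw {N : ℕ} (y : Fin N → E) (p : Fin N → ℝ) : Measure E :=
  ∑ i, ENNReal.ofReal (p i) • Measure.dirac (y i)

/-- The union of the balls whose centre and radius range over the admissible set `V`. -/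
def unionBall {N : ℕ} (D : E → E → ℝ) (y : Fin N → E) (V : Set ((Fin N → ℝ) × ℝ)) :
    Set (Measure E) :=
  ⋃ x ∈ V, otBall D x.2 (discreteLaw y x.1)

/-- The risk functional `ρ(Z) = inf_t 𝔼_Q[ℓ(Z, t)]`. -/
noncomputable def rho {T : Type*} (ℓ : ℝ → T → ℝ) (Q : Measure E) (Z : E → ℝ) : EReal :=
  ⨅ t : T, ((∫ y, ℓ (Z y) t ∂Q : ℝ) : EReal)

end Transport

/-- The admissible pairs with a nonnegative radius. -/
def Vplus {N : ℕ} (V : Set ((Fin N → ℝ) × ℝ)) : Set ((Fin N → ℝ) × ℝ) :=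
  {x ∈ V | 0 ≤ x.2}

/-- The support function of `S`, that is, the convex conjugate of its indicator function. -/
noncomputable def supportFn {N : ℕ} (S : Set ((Fin N → ℝ) × ℝ)) (v : (Fin N → ℝ) × ℝ) : EReal :=
  ⨆ x ∈ S, ((∑ i, v.1 i * x.1 i + v.2 * x.2 : ℝ) : EReal)

/-- Every sublevel set of `f` is bounded. -/
def LevelBounded {T : Type*} [Bornology T] (f : T → ℝ) : Prop :=
  ∀ a : ℝ, Bornology.IsBounded {t | f t ≤ a}

/-- The (smallest) uniform Lipschitz constant of `ℓ(·, t)`, over all `t`. -/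
noncomputable def uniformLip {T : Type*} (ℓ : ℝ → T → ℝ) : ℝ≥0 :=
  sInf {K : ℝ≥0 | ∀ t, LipschitzWith K fun z => ℓ z t}

/-- Minimizing the extended-real-valued function `f` over `S` is a convex program: the feasible set
is convex, and so is the objective on it (its epigraph is convex). -/
def IsConvexProgram {X : Type*} [AddCommGroup X] [Module ℝ X] (S : Set X) (f : X → EReal) : Prop :=
  Convex ℝ S ∧ Convex ℝ {z : X × ℝ | z.1 ∈ S ∧ f z.1 ≤ (z.2 : EReal)}

/-! ### The optimization problems -/

section Problems

variable {E : Type*} [NormedAddCommGroup E] [NormedSpace ℝ E] {N : ℕ}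

/-- The objective of the union-ball problem: the worst case of `ρ_Q(Yᵀα)`. -/
noncomputable def worstCase [MeasurableSpace E] {T : Type*} (D : E → E → ℝ) (y : Fin N → E)
    (V : Set ((Fin N → ℝ) × ℝ)) (ℓ : ℝ → T → ℝ) (α : StrongDual ℝ E) : EReal :=
  ⨆ Q ∈ unionBall D y V, rho ℓ Q (fun u => α u)

/-- The objective of the robust optimization problem for the ground cost `‖y₁ - y₂‖`. -/
noncomputable def robustLip {T : Type*} (y : Fin N → E) (V : Set ((Fin N → ℝ) × ℝ))
    (ℓ : ℝ → T → ℝ) (α : StrongDual ℝ E) (t : T) : EReal :=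
  ⨆ x ∈ Vplus V,
    ((∑ i, x.1 i * ℓ (α (y i)) t + (uniformLip ℓ : ℝ) * x.2 * ‖α‖ : ℝ) : EReal)

/-- The points `(α, t, v)` that are feasible for the program for the ground cost `‖y₁ - y₂‖`. -/
def feasibleLip {T : Type*} (A : Set (StrongDual ℝ E)) (y : Fin N → E) (ℓ : ℝ → T → ℝ) :
    Set (StrongDual ℝ E × T × ((Fin N → ℝ) × ℝ)) :=
  {x | x.1 ∈ A ∧ (∀ i, ℓ (x.1 (y i)) x.2.1 ≤ x.2.2.1 i) ∧ (uniformLip ℓ : ℝ) * ‖x.1‖ ≤ x.2.2.2}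

/-- The objective of the robust optimization problem for the ground cost `‖y₁ - y₂‖ ^ q`. -/
noncomputable def robustPow {T : Type*} (q C : ℝ) (y : Fin N → E) (V : Set ((Fin N → ℝ) × ℝ))
    (ℓ : ℝ → T → ℝ) (α : StrongDual ℝ E) (t : T) : EReal :=
  ⨆ x ∈ Vplus V,
    ((((∑ i, x.1 i * ℓ (α (y i)) t) ^ (1 / q) + C * x.2 ^ (1 / q) * ‖α‖) ^ q : ℝ) : EReal)

open Classical in
/-- `a / s ^ (q - 1)` for `a, s ≥ 0`, with the usual conventions `a / 0 = ∞` for `a > 0` and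
`0 / 0 = 0`. -/
noncomputable def ratio (q a s : ℝ) : EReal :=
  if s = 0 then (if a = 0 then 0 else ⊤) else ((a / s ^ (q - 1) : ℝ) : EReal)

open Classical in
/-- `w * ‖α / w‖ ^ r` for `w ≥ 0`, with the usual conventions at `w = 0`: the value is `∞` for
`α ≠ 0` and `0` for `α = 0`. -/
noncomputable def perspective (r w : ℝ) (α : StrongDual ℝ E) : EReal :=
  if w = 0 then (if α = 0 then 0 else ⊤) else ((w * ‖w⁻¹ • α‖ ^ r : ℝ) : EReal)

/-- The constant `q ^ (1 / (1 - q)) - q ^ (q / (1 - q))`. -/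
noncomputable def constOne (q : ℝ) : ℝ :=
  q ^ (1 / (1 - q)) - q ^ (q / (1 - q))

/-- The constant `C ^ (q / (q - 1)) (q ^ (1 / (1 - q)) - q ^ (q / (1 - q)))`. -/
noncomputable def constTwo (q C : ℝ) : ℝ :=
  C ^ (q / (q - 1)) * (q ^ (1 / (1 - q)) - q ^ (q / (1 - q)))

/-- The points `(α, t, s, v)` that are feasible for the program for the ground cost
`‖y₁ - y₂‖ ^ q`. -/
def feasiblePow (q : ℝ) (A : Set (StrongDual ℝ E)) (y : Fin N → E) (ℓ : ℝ → ℝ → ℝ) :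
    Set (StrongDual ℝ E × ℝ × ℝ × ((Fin N → ℝ) × ℝ)) :=
  {x | x.1 ∈ A ∧ 0 ≤ x.2.2.1 ∧
    (∀ i, ratio q (ℓ (x.1 (y i)) x.2.1) x.2.2.1 ≤ ((x.2.2.2.1 i : ℝ) : EReal)) ∧
    0 ≤ x.2.2.2.2}

/-- The objective, at `(α, t, s, v)`, of the program for the ground cost `‖y₁ - y₂‖ ^ q`. The base
of the power is nonnegative at every feasible point as soon as `Vplus V` is nonempty and consists
of probability weights with a radius. -/
noncomputable def objectivePow (q C : ℝ) (V : Set ((Fin N → ℝ) × ℝ))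
    (x : StrongDual ℝ E × ℝ × ℝ × ((Fin N → ℝ) × ℝ)) : EReal :=
  (((supportFn (Vplus V) x.2.2.2 + ((constOne q * x.2.2.1 : ℝ) : EReal) +
    ((constTwo q C : ℝ) : EReal) *
      perspective (q / (q - 1)) x.2.2.2.2 x.1).toENNReal ^ q : ℝ≥0∞) : EReal)

end Problems

end UnionBall

namespace UnionBall

/-! ### A minimax lemma -/

/-! The proof exchanges the supremum over `Q` with the infimum over `t`, evaluates the supremum over
a single ball exactly, and dualizes the result.

Exchange (`worstCase_eq_iInf_iSup`). Transport balls are jointly convex in centre and radius and `V`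
is convex, so the ambiguity set is closed under mixtures. Expectations are affine in `Q` and convex
in `t`, and a discrete centre has a level bounded expectation, which supplies the compactness for a
minimax argument.

One ball. The upper bound compares `Q` with its centre along a coupling, by the Lipschitz estimate
in (i) and by Minkowski's inequality in `L^q` in (ii). The lower bound moves the atoms along a
vector `u` of the unit ball with `α u = ‖α‖`. In (i) a small fraction of every atom goes far away,
where the loss grows with slope almost `Lip(ℓ)`; by convexity this asymptotic slope is the same at
all points and all `t` (`exists_direction_slope`). In (ii) every atom moves in proportion to its
loss, the equality case of Minkowski, unless the expected loss at the centre is zero; then a small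
fraction goes far away again. The robust objectives are therefore suprema of expectations, which are
jointly convex in `(α, t)`.

Dualization. In (i) the support function is monotone on nonnegative weights, so the constraints may
be taken tight. In (ii) the root satisfies `X ^ (1/q) = min_s (X / s ^ (q-1) + constOne q * s)` for
`X > 0`. It is applied to the expected loss, with variable `s`, and to `(C‖α‖) ^ q * δ`, whose
variable is absorbed into `v_{N+1}` and yields the perspective term. One inequality is pointwise.
The other needs one pair of parameters for all `(p, δ)`; it comes from the tangent plane of a
concave function at its maximizer over a planar convex set (`exists_tangent_majorant`). -/

theorem convexOn_univ_continuous {T : Type*} [NormedAddCommGroup T] [NormedSpace ℝ T]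
    [FiniteDimensional ℝ T] {f : T → ℝ} (hf : ConvexOn ℝ univ f) : Continuous f :=
  continuousOn_univ.1 (hf.continuousOn isOpen_univ)

/-- For a family of convex functions that is closed under taking mixtures and has a level bounded
member, `c < inf_t sup_i f i t` implies `c ≤ sup_i inf_t f i t`. -/
theorem exists_forall_le_of_forall_exists_lt {ι T : Type*} [NormedAddCommGroup T]
    [NormedSpace ℝ T] [FiniteDimensional ℝ T] (f : ι → T → ℝ) (hf : ∀ i, ConvexOn ℝ univ (f i))
    (hmix : ∀ i j (a b : ℝ), 0 ≤ a → 0 ≤ b → a + b = 1 →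
      ∃ k, ∀ t, a * f i t + b * f j t ≤ f k t)
    (i₀ : ι) (hlb : LevelBounded (f i₀)) (c : ℝ) (hc : ∀ t, ∃ i, c < f i t) :
    ∃ i, ∀ t, c ≤ f i t := by
  classical
  have hcont : ∀ i, Continuous (f i) := fun i => convexOn_univ_continuous (hf i)
  have hclosed : ∀ i, IsClosed {t | f i t ≤ c} := fun i => isClosed_le (hcont i) continuous_const
  have : ProperSpace T := FiniteDimensional.proper ℝ T
  have hcomp : IsCompact {t | f i₀ t ≤ c} :=
    Metric.isCompact_of_isClosed_isBounded (hclosed i₀) (hlb c)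
  -- No point of the compact set `f i₀ ≤ c` lies in all the closed sets `f i ≤ c`, so finitely many
  -- indices already exceed `c` everywhere.
  obtain ⟨u, hu⟩ := hcomp.elim_finite_subfamily_closed _ hclosed (by
    ext t
    obtain ⟨i, hi⟩ := hc t
    simp only [mem_inter_iff, mem_iInter, mem_ofPred_eq, mem_empty_iff_false, iff_false, not_and,
      not_forall, not_le]
    exact fun _ => ⟨i, hi⟩)
  set s : Finset ι := insert i₀ u with hs
  have hfin : ∀ t, ∃ i : s, c < f i t := by
    intro t
    by_contra! h
    have : t ∈ {t | f i₀ t ≤ c} ∩ ⋂ i ∈ u, {t | f i t ≤ c} := by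
      refine ⟨h ⟨i₀, by simp [hs]⟩, ?_⟩
      simp only [mem_iInter, mem_ofPred_eq]
      exact fun i hi => h ⟨i, by simp [hs, hi]⟩
    rw [hu] at this
    exact this
  -- The vectors strictly above some value vector `(f i t)_i`. A functional separating this open
  -- convex set from `(c, …, c)` provides the mixture weights.
  let U : Set (s → ℝ) := {v | ∃ t, ∀ i : s, f i t < v i}
  have hUconv : Convex ℝ U := by
    rintro v ⟨t, ht⟩ v' ⟨t', ht'⟩ a b ha hb hab
    refine ⟨a • t + b • t', fun i => ?_⟩
    refine ((hf i).2 (mem_univ t) (mem_univ t') ha hb hab).trans_lt ?_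
    simp only [smul_eq_mul, Pi.add_apply, Pi.smul_apply]
    rcases ha.eq_or_lt with rfl | ha'
    · have : b = 1 := by linarith
      subst this
      linarith [ht' i]
    · have := mul_lt_mul_of_pos_left (ht i) ha'
      have := mul_le_mul_of_nonneg_left (ht' i).le hb
      linarith
  have hUopen : IsOpen U := by
    have : U = ⋃ t, ⋂ i : s, {v : s → ℝ | f i t < v i} := by
      ext v; simp [U]
    rw [this]
    exact isOpen_iUnion fun t => isOpen_iInter_of_finite fun i =>
      isOpen_lt continuous_const (continuous_apply i)
  have hUc : (fun _ => c : s → ℝ) ∉ U := by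
    rintro ⟨t, ht⟩
    obtain ⟨i, hi⟩ := hfin t
    exact lt_asymm hi (ht i)
  obtain ⟨φ, hφ⟩ := geometric_hahn_banach_point_open hUconv hUopen hUc
  set w : s → ℝ := fun i => φ (Pi.single i 1) with hw
  have hφw : ∀ v, φ v = ∑ i, v i * w i := by
    intro v
    conv_lhs => rw [← Finset.univ_sum_single v]
    rw [map_sum]
    refine Finset.sum_congr rfl fun i _ => ?_
    have : (Pi.single i (v i) : s → ℝ) = v i • Pi.single i 1 := by
      rw [← Pi.single_smul]; simp
    rw [this, map_smul, smul_eq_mul]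
  -- `U` is closed under increasing a coordinate; along a coordinate of negative weight `φ` would
  -- drop below its value at `(c, …, c)`.
  have hw0 : ∀ i, 0 ≤ w i := by
    intro i
    by_contra! hneg
    set v₀ : s → ℝ := fun j => f j 0 + 1
    obtain ⟨r, hr0, hr⟩ : ∃ r : ℝ, 0 ≤ r ∧ φ v₀ + r * w i ≤ φ fun _ => c := by
      refine ⟨max 0 ((φ (fun _ => c) - φ v₀) / w i), le_max_left _ _, ?_⟩
      have h1 := mul_le_mul_of_nonpos_right (le_max_right 0 ((φ (fun _ => c) - φ v₀) / w i))
        hneg.le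
      rw [div_mul_cancel₀ _ hneg.ne] at h1
      linarith
    have hmem : v₀ + r • Pi.single i 1 ∈ U := by
      refine ⟨0, fun j => ?_⟩
      have : 0 ≤ r * (Pi.single i 1 : s → ℝ) j := by
        refine mul_nonneg hr0 ?_
        by_cases h : j = i
        · subst h; simp
        · simp [h]
      simp only [v₀, Pi.add_apply, Pi.smul_apply, smul_eq_mul]
      linarith
    have := hφ _ hmem
    rw [map_add, map_smul, smul_eq_mul] at this
    linarith
  have hWpos : 0 < ∑ i, w i := by
    refine (Finset.sum_nonneg fun i _ => hw0 i).lt_of_ne fun h0 => ?_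
    have h1 : ∀ i, w i = 0 := fun i =>
      (Finset.sum_eq_zero_iff_of_nonneg fun i _ => hw0 i).1 h0.symm i (Finset.mem_univ i)
    have h2 := hφ (fun j => f j 0 + 1) ⟨0, fun j => by linarith⟩
    rw [hφw, hφw] at h2
    simp [h1] at h2
  have hkey : ∀ t, c * ∑ i, w i ≤ ∑ i, w i * f i t := by
    intro t
    refine le_of_forall_pos_lt_add fun ε hε => ?_
    have h2 := hφ (fun j => f j t + ε / ∑ i, w i)
      ⟨t, fun j => by linarith [div_pos hε hWpos]⟩
    rw [hφw, hφw, ← Finset.mul_sum] at h2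
    simp only [add_mul, Finset.sum_add_distrib, ← Finset.mul_sum] at h2
    rw [div_mul_cancel₀ _ hWpos.ne'] at h2
    simpa [mul_comm] using h2
  -- `hmix` says that the functions dominated by a member form a convex set; this upgrades mixtures
  -- of two members to mixtures of finitely many.
  have hFconv : Convex ℝ {g : T → ℝ | ∃ k, ∀ t, g t ≤ f k t} := by
    rintro g ⟨i, hi⟩ g' ⟨j, hj⟩ a b ha hb hab
    obtain ⟨k, hk⟩ := hmix i j a b ha hb hab
    refine ⟨k, fun t => le_trans ?_ (hk t)⟩
    simp only [Pi.add_apply, Pi.smul_apply, smul_eq_mul]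
    gcongr
    exacts [hi t, hj t]
  obtain ⟨k, hk⟩ := hFconv.sum_mem (t := Finset.univ) (w := fun i => w i / ∑ i, w i)
    (z := fun i : s => f i) (fun i _ => div_nonneg (hw0 i) hWpos.le)
    (by rw [← Finset.sum_div, div_self hWpos.ne']) (fun i _ => ⟨i, fun t => le_rfl⟩)
  refine ⟨k, fun t => le_trans ?_ (hk t)⟩
  simp only [Finset.sum_apply, Pi.smul_apply, smul_eq_mul, div_mul_eq_mul_div]
  rw [← Finset.sum_div, le_div_iff₀ hWpos]
  exact hkey t

/-! ### Transport balls -/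

section Transport

variable {E : Type*} [MeasurableSpace E] {D : E → E → ℝ} {N : ℕ}

theorem nonneg_of_mem_otBall {δ : ℝ} {P Q : Measure E} (h : Q ∈ otBall D δ P) : 0 ≤ δ := by
  have := (EReal.coe_ennreal_nonneg _).trans h.2
  exact_mod_cast this

/-- The infimum over couplings is not shown to be attained, so a coupling is extracted only at a
slightly larger radius; the estimates are continuous in the radius and pass to the limit. -/
theorem exists_coupling_of_mem_otBall {δ δ' : ℝ} {P Q : Measure E} (h : Q ∈ otBall D δ P)
    (hδ : δ < δ') :
    ∃ π ∈ couplings Q P, ∫⁻ z, ENNReal.ofReal (D z.1 z.2) ∂π ≤ ENNReal.ofReal δ' := by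
  have h0 := nonneg_of_mem_otBall h
  have h1 : otCost D Q P < ENNReal.ofReal δ' := by
    have h2 : ((otCost D Q P : ℝ≥0∞) : EReal) < ((ENNReal.ofReal δ' : ℝ≥0∞) : EReal) := by
      refine h.2.trans_lt ?_
      rw [EReal.coe_ennreal_ofReal, max_eq_left (h0.trans hδ.le)]
      exact_mod_cast hδ
    exact_mod_cast h2
  rw [otCost] at h1
  simp only [iInf_lt_iff] at h1
  obtain ⟨π, hπ, hc⟩ := h1
  exact ⟨π, hπ, hc.le⟩

theorem mem_otBall_of_forall_coupling {δ : ℝ} {P Q : Measure E} (hQ : IsProbabilityMeasure Q)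
    (hδ : 0 ≤ δ)
    (h : ∀ δ' > δ, ∃ π ∈ couplings Q P,
      ∫⁻ z, ENNReal.ofReal (D z.1 z.2) ∂π ≤ ENNReal.ofReal δ') :
    Q ∈ otBall D δ P := by
  refine ⟨hQ, ?_⟩
  have h1 : otCost D Q P ≤ ENNReal.ofReal δ := by
    refine ENNReal.le_of_forall_pos_le_add fun ε hε _ => ?_
    obtain ⟨π, hπ, hc⟩ := h (δ + ε) (by simpa using hε)
    rw [ENNReal.ofReal_add hδ ε.coe_nonneg, ENNReal.ofReal_coe_nnreal] at hc
    exact (iInf₂_le π hπ).trans hc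
  have h2 : ((otCost D Q P : ℝ≥0∞) : EReal) ≤ ((ENNReal.ofReal δ : ℝ≥0∞) : EReal) := by
    exact_mod_cast h1
  rwa [EReal.coe_ennreal_ofReal, max_eq_left hδ] at h2

theorem otBall_mono {δ δ' : ℝ} (h : δ ≤ δ') (P : Measure E) : otBall D δ P ⊆ otBall D δ' P :=
  fun _ hQ => ⟨hQ.1, hQ.2.trans (by exact_mod_cast h)⟩

theorem isProbabilityMeasure_mix {Q₁ Q₂ : Measure E} [IsProbabilityMeasure Q₁]
    [IsProbabilityMeasure Q₂] {a b : ℝ} (ha : 0 ≤ a) (hb : 0 ≤ b) (hab : a + b = 1) :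
    IsProbabilityMeasure (ENNReal.ofReal a • Q₁ + ENNReal.ofReal b • Q₂) := by
  constructor
  simp [← ENNReal.ofReal_add ha hb, hab]

/-- Transport balls are jointly convex in the centre and the radius. -/
theorem mix_mem_otBall {δ₁ δ₂ : ℝ} {P₁ P₂ Q₁ Q₂ : Measure E} (h₁ : Q₁ ∈ otBall D δ₁ P₁)
    (h₂ : Q₂ ∈ otBall D δ₂ P₂) {a b : ℝ} (ha : 0 ≤ a) (hb : 0 ≤ b) (hab : a + b = 1) :
    ENNReal.ofReal a • Q₁ + ENNReal.ofReal b • Q₂ ∈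
      otBall D (a * δ₁ + b * δ₂) (ENNReal.ofReal a • P₁ + ENNReal.ofReal b • P₂) := by
  have := h₁.1
  have := h₂.1
  have hδ₁ := nonneg_of_mem_otBall h₁
  have hδ₂ := nonneg_of_mem_otBall h₂
  refine mem_otBall_of_forall_coupling (isProbabilityMeasure_mix ha hb hab) (by positivity) ?_
  intro δ' hδ'
  -- The same slack serves both couplings, because `a * ε + b * ε = ε`.
  set ε := δ' - (a * δ₁ + b * δ₂) with hε
  have hε0 : 0 < ε := sub_pos.2 hδ'
  obtain ⟨π₁, ⟨hf₁, hs₁⟩, hc₁⟩ := exists_coupling_of_mem_otBall h₁ (lt_add_of_pos_right δ₁ hε0)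
  obtain ⟨π₂, ⟨hf₂, hs₂⟩, hc₂⟩ := exists_coupling_of_mem_otBall h₂ (lt_add_of_pos_right δ₂ hε0)
  refine ⟨ENNReal.ofReal a • π₁ + ENNReal.ofReal b • π₂, ⟨?_, ?_⟩, ?_⟩
  · rw [Measure.map_add _ _ measurable_fst, Measure.map_smul, Measure.map_smul, hf₁, hf₂]
  · rw [Measure.map_add _ _ measurable_snd, Measure.map_smul, Measure.map_smul, hs₁, hs₂]
  · rw [lintegral_add_measure, lintegral_smul_measure, lintegral_smul_measure, smul_eq_mul,
      smul_eq_mul]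
    calc _ ≤ ENNReal.ofReal a * ENNReal.ofReal (δ₁ + ε) +
          ENNReal.ofReal b * ENNReal.ofReal (δ₂ + ε) := by gcongr
      _ = ENNReal.ofReal δ' := by
        rw [← ENNReal.ofReal_mul ha, ← ENNReal.ofReal_mul hb,
          ← ENNReal.ofReal_add (by positivity) (by positivity)]
        congr 1
        linear_combination ε * hab + hε

theorem isProbabilityMeasure_discreteLaw (y : Fin N → E) {p : Fin N → ℝ}
    (hp : p ∈ stdSimplex ℝ (Fin N)) : IsProbabilityMeasure (discreteLaw y p) := by
  constructor
  simp [discreteLaw, ← ENNReal.ofReal_sum_of_nonneg fun i _ => hp.1 i, hp.2]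

theorem discreteLaw_mix (y : Fin N → E) {p p' : Fin N → ℝ} (hp : ∀ i, 0 ≤ p i)
    (hp' : ∀ i, 0 ≤ p' i) {a b : ℝ} (ha : 0 ≤ a) (hb : 0 ≤ b) :
    discreteLaw y (a • p + b • p') =
      ENNReal.ofReal a • discreteLaw y p + ENNReal.ofReal b • discreteLaw y p' := by
  simp only [discreteLaw, Finset.smul_sum, ← Finset.sum_add_distrib, smul_smul, ← add_smul]
  refine Finset.sum_congr rfl fun i _ => ?_
  rw [← ENNReal.ofReal_mul ha, ← ENNReal.ofReal_mul hb, ← ENNReal.ofReal_add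
    (mul_nonneg ha (hp i)) (mul_nonneg hb (hp' i))]
  rfl

/-- The ambiguity set is closed under mixtures. -/
theorem mix_mem_unionBall {y : Fin N → E} {V : Set ((Fin N → ℝ) × ℝ)} (hV : Convex ℝ V)
    (hp : ∀ x ∈ V, x.1 ∈ stdSimplex ℝ (Fin N)) {Q₁ Q₂ : Measure E}
    (h₁ : Q₁ ∈ unionBall D y V) (h₂ : Q₂ ∈ unionBall D y V)
    {a b : ℝ} (ha : 0 ≤ a) (hb : 0 ≤ b) (hab : a + b = 1) :
    ENNReal.ofReal a • Q₁ + ENNReal.ofReal b • Q₂ ∈ unionBall D y V := by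
  simp only [unionBall, mem_iUnion, exists_prop] at h₁ h₂ ⊢
  obtain ⟨x₁, hx₁, hQ₁⟩ := h₁
  obtain ⟨x₂, hx₂, hQ₂⟩ := h₂
  refine ⟨a • x₁ + b • x₂, hV hx₁ hx₂ ha hb hab, ?_⟩
  have := mix_mem_otBall hQ₁ hQ₂ ha hb hab
  rwa [← discreteLaw_mix y (hp _ hx₁).1 (hp _ hx₂).1 ha hb] at this

theorem map_discreteLaw {F : Type*} [MeasurableSpace F] (y : Fin N → E) (p : Fin N → ℝ)
    {g : E → F} (hg : Measurable g) :
    (discreteLaw y p).map g = discreteLaw (fun i => g (y i)) p := by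
  simp only [discreteLaw]
  rw [Measure.map_finset_sum hg.aemeasurable]
  simp [Measure.map_smul, Measure.map_dirac' hg]

theorem integral_mix {Q₁ Q₂ : Measure E} {a b : ℝ} (ha : 0 ≤ a) (hb : 0 ≤ b) {g : E → ℝ}
    (h₁ : Integrable g Q₁) (h₂ : Integrable g Q₂) :
    ∫ u, g u ∂(ENNReal.ofReal a • Q₁ + ENNReal.ofReal b • Q₂) =
      a * ∫ u, g u ∂Q₁ + b * ∫ u, g u ∂Q₂ := by
  rw [integral_add_measure (h₁.smul_measure ENNReal.ofReal_ne_top)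
    (h₂.smul_measure ENNReal.ofReal_ne_top), integral_smul_measure, integral_smul_measure,
    ENNReal.toReal_ofReal ha, ENNReal.toReal_ofReal hb, smul_eq_mul, smul_eq_mul]

/-- The worst case over each ball yields the worst case over the union of the balls. -/
theorem iSup_Vplus_eq_iSup_unionBall {y : Fin N → E}
    {V : Set ((Fin N → ℝ) × ℝ)} {f : Measure E → ℝ} {g : (Fin N → ℝ) × ℝ → ℝ}
    (hupper : ∀ x ∈ Vplus V, ∀ Q ∈ otBall D x.2 (discreteLaw y x.1), f Q ≤ g x)
    (hlower : ∀ x ∈ Vplus V, ∀ c < g x, ∃ Q ∈ otBall D x.2 (discreteLaw y x.1), c < f Q) :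
    ⨆ x ∈ Vplus V, ((g x : ℝ) : EReal) = ⨆ Q ∈ unionBall D y V, ((f Q : ℝ) : EReal) := by
  refine le_antisymm (iSup₂_le fun x hx => ?_) (iSup₂_le fun Q hQ => ?_)
  · refine EReal.ge_of_forall_gt_iff_ge.1 fun c hc => ?_
    obtain ⟨Q, hQ, hcQ⟩ := hlower x hx c (by exact_mod_cast hc)
    refine le_iSup₂_of_le Q ?_ (by exact_mod_cast hcQ.le)
    simp only [unionBall, mem_iUnion, exists_prop]
    exact ⟨x, hx.1, hQ⟩
  · simp only [unionBall, mem_iUnion, exists_prop] at hQ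
    obtain ⟨x, hx, hQ⟩ := hQ
    have hx' : x ∈ Vplus V := ⟨hx, nonneg_of_mem_otBall hQ⟩
    exact le_iSup₂_of_le x hx' (by exact_mod_cast hupper x hx' Q hQ)

variable [MeasurableSingletonClass E]

theorem lintegral_discreteLaw (y : Fin N → E) (p : Fin N → ℝ) (g : E → ℝ≥0∞) :
    ∫⁻ u, g u ∂discreteLaw y p = ∑ i, ENNReal.ofReal (p i) * g (y i) := by
  simp [discreteLaw, lintegral_finsetSum_measure]

theorem integrable_discreteLaw (y : Fin N → E) (p : Fin N → ℝ) (g : E → ℝ) :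
    Integrable g (discreteLaw y p) := by
  rw [discreteLaw, integrable_finsetSum_measure]
  exact fun i _ => (integrable_dirac (by simp)).smul_measure ENNReal.ofReal_ne_top

theorem integral_discreteLaw (y : Fin N → E) {p : Fin N → ℝ} (hp : ∀ i, 0 ≤ p i) (g : E → ℝ) :
    ∫ u, g u ∂discreteLaw y p = ∑ i, p i * g (y i) := by
  rw [discreteLaw, integral_finsetSum_measure
    fun i _ => (integrable_dirac (by simp)).smul_measure ENNReal.ofReal_ne_top]
  simp [integral_smul_measure, ENNReal.toReal_ofReal (hp _)]

/-- Moving the atoms `y i` to `x i`. -/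
theorem discreteLaw_mem_otBall (hD : ∀ u v, 0 ≤ D u v) (x y : Fin N → E) {p : Fin N → ℝ}
    (hp : p ∈ stdSimplex ℝ (Fin N)) {δ : ℝ} (hδ : ∑ i, p i * D (x i) (y i) ≤ δ) :
    discreteLaw x p ∈ otBall D δ (discreteLaw y p) := by
  have h0 : 0 ≤ ∑ i, p i * D (x i) (y i) :=
    Finset.sum_nonneg fun i _ => mul_nonneg (hp.1 i) (hD _ _)
  refine mem_otBall_of_forall_coupling (isProbabilityMeasure_discreteLaw x hp) (h0.trans hδ) ?_
  intro δ' hδ'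
  refine ⟨discreteLaw (fun i => (x i, y i)) p,
    ⟨map_discreteLaw _ p measurable_fst, map_discreteLaw _ p measurable_snd⟩, ?_⟩
  rw [lintegral_discreteLaw]
  calc _ = ∑ i, ENNReal.ofReal (p i * D (x i) (y i)) := by
        simp [ENNReal.ofReal_mul (hp.1 _)]
    _ = ENNReal.ofReal (∑ i, p i * D (x i) (y i)) :=
        (ENNReal.ofReal_sum_of_nonneg fun i _ => mul_nonneg (hp.1 i) (hD _ _)).symm
    _ ≤ _ := ENNReal.ofReal_le_ofReal (hδ.trans hδ'.le)

theorem discreteLaw_mem_otBall_self (hD : ∀ u v, 0 ≤ D u v) (hD0 : ∀ u, D u u = 0)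
    (y : Fin N → E) {p : Fin N → ℝ} (hp : p ∈ stdSimplex ℝ (Fin N)) {δ : ℝ} (hδ : 0 ≤ δ) :
    discreteLaw y p ∈ otBall D δ (discreteLaw y p) :=
  discreteLaw_mem_otBall hD y y hp (by simpa [hD0] using hδ)

/-- Moving the fraction `ε` of the mass of each atom `y i` to `x i`. -/
theorem exists_mem_otBall_integral_eq (hD : ∀ u v, 0 ≤ D u v) (hD0 : ∀ u, D u u = 0)
    (x y : Fin N → E) {p : Fin N → ℝ} (hp : p ∈ stdSimplex ℝ (Fin N)) {δ ε : ℝ} (hε : 0 ≤ ε)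
    (hε1 : ε ≤ 1) (hδ : ε * ∑ i, p i * D (x i) (y i) ≤ δ) :
    ∃ Q ∈ otBall D δ (discreteLaw y p), ∀ g : E → ℝ,
      ∫ u, g u ∂Q = (1 - ε) * (∑ i, p i * g (y i)) + ε * ∑ i, p i * g (x i) := by
  have h1ε : 0 ≤ 1 - ε := sub_nonneg.2 hε1
  have hmem := mix_mem_otBall (discreteLaw_mem_otBall_self hD hD0 y hp le_rfl)
    (discreteLaw_mem_otBall hD x y hp le_rfl) h1ε hε (by ring)
  have hP : ENNReal.ofReal (1 - ε) • discreteLaw y p + ENNReal.ofReal ε • discreteLaw y p =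
      discreteLaw y p := by
    rw [← add_smul, ← ENNReal.ofReal_add h1ε hε]
    simp
  rw [hP] at hmem
  refine ⟨_, otBall_mono (by linarith) _ hmem, fun g => ?_⟩
  rw [integral_mix h1ε hε (integrable_discreteLaw y p g) (integrable_discreteLaw x p g),
    integral_discreteLaw y hp.1, integral_discreteLaw x hp.1]

end Transport

/-! ### Duality for a general loss -/

section Duality

variable {E : Type*} [NormedAddCommGroup E] [NormedSpace ℝ E] [MeasurableSpace E]
  {N : ℕ} {T : Type*} [NormedAddCommGroup T] [NormedSpace ℝ T]

theorem convexOn_integral {ℓ : ℝ → T → ℝ}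
    (hconv : ConvexOn ℝ univ (fun x : ℝ × T => ℓ x.1 x.2)) {Q : Measure E}
    (hint : ∀ (α : StrongDual ℝ E) t, Integrable (fun u => ℓ (α u) t) Q) :
    ConvexOn ℝ univ (fun x : StrongDual ℝ E × T => ∫ u, ℓ (x.1 u) x.2 ∂Q) := by
  refine ⟨convex_univ, fun x _ x' _ a b ha hb hab => ?_⟩
  simp only [smul_eq_mul]
  rw [← integral_const_mul, ← integral_const_mul,
    ← integral_add ((hint _ _).const_mul a) ((hint _ _).const_mul b)]
  refine integral_mono (hint _ _) (((hint _ _).const_mul a).add ((hint _ _).const_mul b)) ?_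
  intro u
  simpa using hconv.2 (mem_univ (x.1 u, x.2)) (mem_univ (x'.1 u, x'.2)) ha hb hab

theorem convexOn_snd {X : Type*} [AddCommGroup X] [Module ℝ X] {f : X × T → ℝ}
    (hf : ConvexOn ℝ univ f) (x : X) : ConvexOn ℝ univ (fun t => f (x, t)) := by
  refine ⟨convex_univ, fun t _ t' _ a b ha hb hab => ?_⟩
  have := hf.2 (mem_univ (x, t)) (mem_univ (x, t')) ha hb hab
  rwa [Prod.smul_mk, Prod.smul_mk, Prod.mk_add_mk, ← add_smul, hab, one_smul] at this

theorem exists_le_of_levelBounded [FiniteDimensional ℝ T] {f : T → ℝ}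
    (hf : ConvexOn ℝ univ f) (hlb : LevelBounded f) : ∃ m, ∀ t, m ≤ f t := by
  have : ProperSpace T := FiniteDimensional.proper ℝ T
  have hcont := convexOn_univ_continuous hf
  have hcomp : IsCompact {t | f t ≤ f 0} :=
    Metric.isCompact_of_isClosed_isBounded (isClosed_le hcont continuous_const) (hlb _)
  obtain ⟨t₀, ht₀, hmin⟩ := hcomp.exists_isMinOn ⟨0, le_refl (f 0)⟩ hcont.continuousOn
  refine ⟨f t₀, fun t => ?_⟩
  by_cases ht : f t ≤ f 0
  · exact hmin ht
  · exact le_trans ht₀ (not_le.1 ht).le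

/-- Some weight is positive and the other terms are bounded below, so a sublevel set of the sum lies
in one of that single term. -/
theorem levelBounded_sum [FiniteDimensional ℝ T] {f : Fin N → T → ℝ}
    (hf : ∀ i, ConvexOn ℝ univ (f i)) (hlb : ∀ i, LevelBounded (f i)) {p : Fin N → ℝ}
    (hp : p ∈ stdSimplex ℝ (Fin N)) : LevelBounded (fun t => ∑ i, p i * f i t) := by
  choose m hm using fun i => exists_le_of_levelBounded (hf i) (hlb i)
  obtain ⟨j, hj⟩ : ∃ j, 0 < p j := by
    by_contra! h
    have h1 := Finset.sum_nonpos fun i (_ : i ∈ Finset.univ) => h i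
    rw [hp.2] at h1
    linarith
  intro a
  refine (hlb j ((a - ∑ i ∈ Finset.univ.erase j, p i * m i) / p j)).subset fun t ht => ?_
  simp only [mem_ofPred_eq] at ht ⊢
  rw [le_div_iff₀ hj]
  rw [← Finset.add_sum_erase _ _ (Finset.mem_univ j)] at ht
  have h1 : ∑ i ∈ Finset.univ.erase j, p i * m i ≤ ∑ i ∈ Finset.univ.erase j, p i * f i t :=
    Finset.sum_le_sum fun i _ => mul_le_mul_of_nonneg_left (hm i t) (hp.1 i)
  linarith

variable {D : E → E → ℝ} {y : Fin N → E} {V : Set ((Fin N → ℝ) × ℝ)} {ℓ : ℝ → T → ℝ}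

/-- A supremum of convex functions is convex. Both robust problems inherit convexity from this form,
without inspecting their closed expressions. -/
theorem isConvexProgram_iSup_integral {A : Set (StrongDual ℝ E)} (hA : Convex ℝ A)
    (hconv : ConvexOn ℝ univ (fun x : ℝ × T => ℓ x.1 x.2))
    (hint : ∀ Q ∈ unionBall D y V, ∀ (α : StrongDual ℝ E) t,
      Integrable (fun u => ℓ (α u) t) Q) :
    IsConvexProgram (A ×ˢ (univ : Set T))
      (fun x => ⨆ Q ∈ unionBall D y V, ((∫ u, ℓ (x.1 u) x.2 ∂Q : ℝ) : EReal)) := by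
  have hS : Convex ℝ (A ×ˢ (univ : Set T)) := hA.prod convex_univ
  refine ⟨hS, ?_⟩
  rintro ⟨x, c⟩ ⟨hx, hc⟩ ⟨x', c'⟩ ⟨hx', hc'⟩ a b ha hb hab
  refine ⟨hS hx hx' ha hb hab, ?_⟩
  simp only [iSup_le_iff, EReal.coe_le_coe_iff] at hc hc' ⊢
  intro Q hQ
  refine ((convexOn_integral hconv (hint Q hQ)).2 (mem_univ x) (mem_univ x') ha hb hab).trans ?_
  simp only [smul_eq_mul, Prod.smul_mk, Prod.mk_add_mk]
  gcongr
  exacts [hc Q hQ, hc' Q hQ]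

variable [MeasurableSingletonClass E]

/-- Minimax duality for the union-ball problem. -/
theorem worstCase_eq_iInf_iSup [FiniteDimensional ℝ T] (hD : ∀ u v, 0 ≤ D u v)
    (hD0 : ∀ u, D u u = 0) (hV : Convex ℝ V) (hp : ∀ x ∈ V, x.1 ∈ stdSimplex ℝ (Fin N))
    (hconv : ConvexOn ℝ univ (fun x : ℝ × T => ℓ x.1 x.2)) (hlb : ∀ z, LevelBounded (ℓ z))
    (hint : ∀ Q ∈ unionBall D y V, ∀ (α : StrongDual ℝ E) t, Integrable (fun u => ℓ (α u) t) Q)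
    (α : StrongDual ℝ E) :
    worstCase D y V ℓ α = ⨅ t, ⨆ Q ∈ unionBall D y V, ((∫ u, ℓ (α u) t ∂Q : ℝ) : EReal) := by
  refine le_antisymm (le_iInf fun t => iSup₂_mono fun Q _ => iInf_le _ t) ?_
  refine EReal.ge_of_forall_gt_iff_ge.1 fun c hc => ?_
  have hc' : ∀ t, ∃ Q : unionBall D y V, c < ∫ u, ℓ (α u) t ∂Q.1 := by
    intro t
    have := hc.trans_le (iInf_le _ t)
    simp only [lt_iSup_iff, EReal.coe_lt_coe_iff] at this
    obtain ⟨Q, hQ, h⟩ := this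
    exact ⟨⟨Q, hQ⟩, h⟩
  -- The ambiguity set is nonempty, so some ball has a nonnegative radius and contains its own
  -- discrete centre, which serves as the level bounded member.
  obtain ⟨⟨Q₀, hQ₀⟩, -⟩ := hc' 0
  simp only [unionBall, mem_iUnion, exists_prop] at hQ₀
  obtain ⟨x, hx, hQ₀⟩ := hQ₀
  have hP : discreteLaw y x.1 ∈ unionBall D y V := by
    simp only [unionBall, mem_iUnion, exists_prop]
    exact ⟨x, hx, discreteLaw_mem_otBall_self hD hD0 y (hp x hx) (nonneg_of_mem_otBall hQ₀)⟩
  obtain ⟨⟨Q, hQ⟩, hcQ⟩ := exists_forall_le_of_forall_exists_lt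
    (fun (Q : unionBall D y V) t => ∫ u, ℓ (α u) t ∂Q.1)
    (fun Q => convexOn_snd (convexOn_integral hconv (hint Q.1 Q.2)) α)
    (fun Q Q' a b ha hb hab =>
      ⟨⟨_, mix_mem_unionBall hV hp Q.2 Q'.2 ha hb hab⟩, fun t =>
        (integral_mix ha hb (hint Q.1 Q.2 α t) (hint Q'.1 Q'.2 α t)).ge⟩)
    ⟨_, hP⟩ (by
      simp only [integral_discreteLaw y (hp x hx).1]
      exact levelBounded_sum (fun i => convexOn_snd hconv (α (y i))) (fun i => hlb _) (hp x hx))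
    c hc'
  exact le_iSup₂_of_le Q hQ (le_iInf fun t => by exact_mod_cast hcQ t)

end Duality

/-! ### Lipschitz losses -/

theorem le_of_forall_gt_of_continuousAt {Φ : ℝ → ℝ} {a δ : ℝ} (hΦ : ContinuousAt Φ δ)
    (h : ∀ δ' > δ, a ≤ Φ δ') : a ≤ Φ δ :=
  ge_of_tendsto (hΦ.tendsto.mono_left (nhdsWithin_le_nhds (s := Ioi δ)))
    (Filter.eventually_of_mem self_mem_nhdsWithin h)

theorem exists_norm_le_one_apply_eq_norm {E : Type*} [NormedAddCommGroup E] [NormedSpace ℝ E]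
    [FiniteDimensional ℝ E] (α : StrongDual ℝ E) : ∃ u, ‖u‖ ≤ 1 ∧ α u = ‖α‖ := by
  have : ProperSpace E := FiniteDimensional.proper ℝ E
  obtain ⟨u, hu, hmax⟩ := (isCompact_closedBall (0 : E) 1).exists_isMaxOn ⟨0, by simp⟩
    α.continuous.continuousOn
  have hu' : ‖u‖ ≤ 1 := by simpa using hu
  have hmax' : ∀ x, ‖x‖ ≤ 1 → α x ≤ α u := fun x hx => hmax (by simpa using hx)
  have h0 : 0 ≤ α u := by simpa using hmax' 0 (by simp)
  have hle : ∀ x, α x ≤ α u * ‖x‖ := by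
    intro x
    rcases eq_or_ne x 0 with rfl | hx
    · simp
    · have hx' : 0 < ‖x‖ := norm_pos_iff.2 hx
      have := hmax' (‖x‖⁻¹ • x) (by rw [norm_smul, norm_inv, norm_norm, inv_mul_cancel₀ hx'.ne'])
      rw [map_smul, smul_eq_mul, inv_mul_le_iff₀ hx'] at this
      linarith
  refine ⟨u, hu', le_antisymm ?_ (α.opNorm_le_bound h0 fun x => ?_)⟩
  · refine (le_abs_self _).trans ((α.le_opNorm u).trans ?_)
    exact mul_le_of_le_one_right (norm_nonneg _) hu'
  · rw [Real.norm_eq_abs, abs_le]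
    have := hle (-x)
    rw [map_neg, norm_neg] at this
    exact ⟨by linarith, hle x⟩

section Lipschitz

variable {E : Type*} [NormedAddCommGroup E] [NormedSpace ℝ E] [FiniteDimensional ℝ E]
  [MeasurableSpace E] [BorelSpace E] {N : ℕ}

/-- Integrate `h z.1 ≤ h z.2 + K * ‖z.1 - z.2‖` over a coupling. The difference is dominated by the
integrable cost, so integrability passes from the discrete centre to `Q`. -/
theorem integrable_and_integral_le_of_lipschitz {h : E → ℝ} {K : ℝ≥0} (hh : LipschitzWith K h)
    {y : Fin N → E} {p : Fin N → ℝ} (hp : ∀ i, 0 ≤ p i) {δ : ℝ} {Q : Measure E}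
    (hQ : Q ∈ otBall (fun y₁ y₂ : E => ‖y₁ - y₂‖) δ (discreteLaw y p)) :
    Integrable h Q ∧ ∫ u, h u ∂Q ≤ ∑ i, p i * h (y i) + K * δ := by
  have : ProperSpace E := FiniteDimensional.proper ℝ E
  have hδ := nonneg_of_mem_otBall hQ
  have key : ∀ δ' > δ, Integrable h Q ∧ ∫ u, h u ∂Q ≤ ∑ i, p i * h (y i) + K * δ' := by
    intro δ' hδ'
    obtain ⟨π, ⟨hf, hs⟩, hc⟩ := exists_coupling_of_mem_otBall hQ hδ'
    have hmeas : Measurable h := hh.continuous.measurable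
    have hDint : Integrable (fun z : E × E => ‖z.1 - z.2‖) π := by
      refine ⟨(measurable_fst.sub measurable_snd).norm.aestronglyMeasurable, ?_⟩
      rw [hasFiniteIntegral_iff_ofReal (Filter.Eventually.of_forall fun z => norm_nonneg _)]
      exact hc.trans_lt ENNReal.ofReal_lt_top
    have hDle : ∫ z, ‖z.1 - z.2‖ ∂π ≤ δ' := by
      rw [integral_eq_lintegral_of_nonneg_ae
        (Filter.Eventually.of_forall fun z => norm_nonneg _) hDint.1]
      exact ENNReal.toReal_le_of_le_ofReal (hδ.trans hδ'.le) hc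
    have hsnd : Integrable (fun z : E × E => h z.2) π := by
      have := integrable_discreteLaw y p h
      rw [← hs] at this
      exact this.comp_measurable measurable_snd
    have hdiff : ∀ z : E × E, |h z.1 - h z.2| ≤ K * ‖z.1 - z.2‖ := fun z => by
      simpa [Real.dist_eq, dist_eq_norm] using hh.dist_le_mul z.1 z.2
    have hdiffint : Integrable (fun z : E × E => h z.1 - h z.2) π :=
      (hDint.const_mul (K : ℝ)).mono'
        ((hmeas.comp measurable_fst).sub (hmeas.comp measurable_snd)).aestronglyMeasurable
        (Filter.Eventually.of_forall hdiff)
    have hfst : Integrable (fun z : E × E => h z.1) π := by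
      refine (hdiffint.add hsnd).congr (Filter.Eventually.of_forall fun z => ?_)
      simp
    have hQint : Integrable h Q := by
      rw [← hf, integrable_map_measure hmeas.aestronglyMeasurable measurable_fst.aemeasurable]
      exact hfst
    refine ⟨hQint, ?_⟩
    have hP : ∫ z, h z.2 ∂π = ∑ i, p i * h (y i) := by
      rw [← integral_discreteLaw y hp, ← hs,
        integral_map measurable_snd.aemeasurable hmeas.aestronglyMeasurable]
    calc ∫ u, h u ∂Q = ∫ z, h z.1 ∂π := by
          rw [← hf, integral_map measurable_fst.aemeasurable hmeas.aestronglyMeasurable]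
      _ ≤ ∫ z, (h z.2 + K * ‖z.1 - z.2‖) ∂π :=
          integral_mono hfst (hsnd.add (hDint.const_mul _)) fun z => by
            have := (abs_le.1 (hdiff z)).2
            simp only
            linarith
      _ = ∑ i, p i * h (y i) + K * ∫ z, ‖z.1 - z.2‖ ∂π := by
          rw [integral_add hsnd (hDint.const_mul _), hP, integral_const_mul]
      _ ≤ _ := by gcongr
  refine ⟨(key (δ + 1) (by linarith)).1, ?_⟩
  exact le_of_forall_gt_of_continuousAt (Φ := fun δ' => ∑ i, p i * h (y i) + K * δ')
    (by fun_prop) fun δ' hδ' => (key δ' hδ').2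

end Lipschitz

/-! ### Asymptotic slopes of jointly convex losses. -/

section Slope

theorem lipschitzWith_uniformLip {T : Type*} {ℓ : ℝ → T → ℝ}
    (hlip : ∃ K : ℝ≥0, ∀ t, LipschitzWith K fun z => ℓ z t) (t : T) :
    LipschitzWith (uniformLip ℓ) fun z => ℓ z t := by
  refine LipschitzWith.of_dist_le_mul fun z z' => ?_
  refine le_of_forall_gt_of_continuousAt (Φ := fun K : ℝ => K * dist z z') (by fun_prop) ?_
  intro K hK
  have hK0 : 0 ≤ K := (NNReal.coe_nonneg _).trans hK.le
  have hK' : uniformLip ℓ < K.toNNReal := by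
    rwa [← NNReal.coe_lt_coe, Real.coe_toNNReal _ hK0]
  obtain ⟨K', hK', hlt⟩ := exists_lt_of_csInf_lt hlip hK'
  refine ((hK' t).dist_le_mul z z').trans (mul_le_mul_of_nonneg_right ?_ dist_nonneg)
  rw [← Real.coe_toNNReal K hK0]
  exact_mod_cast hlt.le

/-- A linear bound for a convex function along a ray holds along all parallel rays. -/
theorem le_add_mul_of_forall_le {X : Type*} [NormedAddCommGroup X] [NormedSpace ℝ X]
    [FiniteDimensional ℝ X] {f : X → ℝ} (hf : ConvexOn ℝ univ f) {x d : X} {r : ℝ}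
    (h : ∀ s : ℝ, 0 ≤ s → f (x + s • d) ≤ f x + r * s) (x' : X) {s : ℝ} (hs : 0 ≤ s) :
    f (x' + s • d) ≤ f x' + r * s := by
  have hcont := convexOn_univ_continuous hf
  -- Mix `x'` with the remote point `x + (s / a) • d` at weight `a`: the displacement is always `s •
  -- d`, and the influence of `x` vanishes as `a → 0`.
  have h1 : ∀ a : ℝ, 0 < a → a ≤ 1 →
      f ((1 - a) • x' + a • x + s • d) ≤ (1 - a) * f x' + a * f x + r * s := by
    intro a ha ha1
    have h2 := hf.2 (mem_univ x') (mem_univ (x + (s / a) • d)) (sub_nonneg.2 ha1) ha.le (by ring)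
    have h3 := mul_le_mul_of_nonneg_left (h (s / a) (by positivity)) ha.le
    rw [smul_add, smul_smul, mul_div_cancel₀ _ ha.ne', ← add_assoc] at h2
    have h4 : a * (f x + r * (s / a)) = a * f x + r * s := by field_simp
    simp only [smul_eq_mul] at h2
    linarith
  have h2 : Filter.Tendsto (fun a : ℝ => f ((1 - a) • x' + a • x + s • d)) (nhdsWithin 0 (Ioi 0))
      (nhds (f ((1 - 0 : ℝ) • x' + (0 : ℝ) • x + s • d))) :=
    ((by fun_prop : Continuous fun a : ℝ => f ((1 - a) • x' + a • x + s • d)).tendsto 0).mono_left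
      nhdsWithin_le_nhds
  have h3 : Filter.Tendsto (fun a : ℝ => (1 - a) * f x' + a * f x + r * s) (nhdsWithin 0 (Ioi 0))
      (nhds ((1 - 0) * f x' + 0 * f x + r * s)) :=
    ((by fun_prop : Continuous fun a : ℝ => (1 - a) * f x' + a * f x + r * s).tendsto 0).mono_left
      nhdsWithin_le_nhds
  have h4 := le_of_tendsto_of_tendsto h2 h3 (by
    filter_upwards [Ioo_mem_nhdsGT (zero_lt_one' ℝ)] with a ha
    exact h1 a ha.1 ha.2.le)
  simpa using h4

/-- If a convex function stays below a line at arbitrarily distant points of a ray, it stays below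
the line along the ray. -/
theorem le_add_mul_of_frequently {X : Type*} [AddCommGroup X] [Module ℝ X] {f : X → ℝ}
    (hf : ConvexOn ℝ univ f) {x d : X} {r : ℝ}
    (h : ∀ s₀ : ℝ, 0 < s₀ → ∃ s ≥ s₀, f (x + s • d) < f x + r * s) {s : ℝ} (hs : 0 ≤ s) :
    f (x + s • d) ≤ f x + r * s := by
  obtain ⟨S, hS, hlt⟩ := h (s + 1) (by linarith)
  have hS0 : 0 < S := by linarith
  have h1 : s / S ≤ 1 := (div_le_one hS0).2 (by linarith)
  have h0 : 0 ≤ s / S := by positivity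
  have h2 := hf.2 (mem_univ x) (mem_univ (x + S • d)) (sub_nonneg.2 h1) h0 (by ring)
  rw [smul_add, ← add_assoc, ← add_smul, sub_add_cancel, one_smul, smul_smul,
    div_mul_cancel₀ _ hS0.ne'] at h2
  simp only [smul_eq_mul] at h2
  have h3 := mul_le_mul_of_nonneg_left hlt.le h0
  have h4 : s / S * (f x + r * S) = s / S * f x + r * s := by field_simp
  linarith

/-- The smallest uniform Lipschitz constant is the asymptotic slope in one of the two directions,
at all points at once. -/
theorem exists_direction_slope {T : Type*} [NormedAddCommGroup T] [NormedSpace ℝ T]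
    [FiniteDimensional ℝ T] {ℓ : ℝ → T → ℝ}
    (hconv : ConvexOn ℝ univ (fun x : ℝ × T => ℓ x.1 x.2)) :
    ∃ σ : ℝ, |σ| = 1 ∧ ∀ z t, ∀ L' < (uniformLip ℓ : ℝ), ∃ s₀ : ℝ, 0 < s₀ ∧ ∀ s ≥ s₀,
      ℓ z t + L' * s ≤ ℓ (z + s * σ) t := by
  -- If each direction fails, possibly at different points, then each has a slope below `uniformLip
  -- ℓ` that bounds the growth along one ray, hence along all parallel rays. The larger of the two
  -- slopes is a uniform Lipschitz constant that is too small.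
  by_contra! hcon
  have hbound : ∀ σ : ℝ, |σ| = 1 → ∃ L' < (uniformLip ℓ : ℝ), ∀ z t (s : ℝ), 0 ≤ s →
      ℓ (z + s * σ) t ≤ ℓ z t + L' * s := by
    intro σ hσ
    obtain ⟨z, t, L', hL', h⟩ := hcon σ hσ
    refine ⟨L', hL', fun z' t' s hs => ?_⟩
    have h1 : ∀ s : ℝ, 0 ≤ s → (fun x : ℝ × T => ℓ x.1 x.2) ((z, t) + s • (σ, (0 : T))) ≤
        (fun x : ℝ × T => ℓ x.1 x.2) (z, t) + L' * s := fun s hs =>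
      le_add_mul_of_frequently hconv (by simpa using h) hs
    simpa using le_add_mul_of_forall_le hconv h1 (z', t') hs
  obtain ⟨L₁, hL₁, h₁⟩ := hbound 1 (by simp)
  obtain ⟨L₂, hL₂, h₂⟩ := hbound (-1) (by simp)
  set M := max L₁ L₂ with hM
  have hML : M < uniformLip ℓ := max_lt hL₁ hL₂
  have hle : ∀ z z' t, ℓ z' t - ℓ z t ≤ M * |z' - z| := by
    intro z z' t
    rcases le_total z z' with hz | hz
    · have h := h₁ z t (z' - z) (sub_nonneg.2 hz)
      rw [mul_one, add_sub_cancel] at h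
      rw [abs_of_nonneg (sub_nonneg.2 hz)]
      have := mul_le_mul_of_nonneg_right (le_max_left L₁ L₂) (sub_nonneg.2 hz)
      linarith
    · have h := h₂ z t (z - z') (sub_nonneg.2 hz)
      rw [show z + (z - z') * -1 = z' by ring] at h
      rw [abs_sub_comm, abs_of_nonneg (sub_nonneg.2 hz)]
      have := mul_le_mul_of_nonneg_right (le_max_right L₁ L₂) (sub_nonneg.2 hz)
      linarith
  have hM0 : 0 ≤ M := by
    have h1 := hle 0 1 0
    have h2 := hle 1 0 0
    norm_num at h1 h2
    linarith
  have hmem : M.toNNReal ∈ {K : ℝ≥0 | ∀ t, LipschitzWith K fun z => ℓ z t} := by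
    intro t
    refine LipschitzWith.of_dist_le_mul fun z z' => ?_
    rw [Real.coe_toNNReal _ hM0, Real.dist_eq, Real.dist_eq, abs_le]
    have h1 := hle z z' t
    have h2 := hle z' z t
    rw [abs_sub_comm] at h1
    exact ⟨by linarith, h2⟩
  have h3 : uniformLip ℓ ≤ M.toNNReal := csInf_le (OrderBot.bddBelow _) hmem
  have h4 : (uniformLip ℓ : ℝ) ≤ M := by
    rw [← Real.coe_toNNReal _ hM0]
    exact_mod_cast h3
  linarith

end Slope

/-! ### Worst case over one ball for a Lipschitz loss. -/

section LipschitzDuality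

variable {E : Type*} [NormedAddCommGroup E] [NormedSpace ℝ E] [FiniteDimensional ℝ E]
  [MeasurableSpace E] [BorelSpace E] {N : ℕ} {T : Type*}

theorem integrable_and_integral_le_uniformLip {ℓ : ℝ → T → ℝ}
    (hlip : ∃ K : ℝ≥0, ∀ t, LipschitzWith K fun z => ℓ z t)
    {y : Fin N → E} {p : Fin N → ℝ} (hp : ∀ i, 0 ≤ p i) {δ : ℝ} {Q : Measure E}
    (hQ : Q ∈ otBall (fun y₁ y₂ : E => ‖y₁ - y₂‖) δ (discreteLaw y p)) (α : StrongDual ℝ E)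
    (t : T) :
    Integrable (fun u => ℓ (α u) t) Q ∧
      ∫ u, ℓ (α u) t ∂Q ≤ ∑ i, p i * ℓ (α (y i)) t + (uniformLip ℓ : ℝ) * δ * ‖α‖ := by
  have h := integrable_and_integral_le_of_lipschitz
    ((lipschitzWith_uniformLip hlip t).comp α.lipschitz) hp hQ
  refine ⟨h.1, h.2.trans_eq ?_⟩
  simp only [NNReal.coe_mul, coe_nnnorm, Function.comp]
  ring

/-- Moving the fraction `δ * ‖α‖ / s` of every atom over a distance at most `s / ‖α‖` costs at most
`δ` and shifts `α` by `s` on that fraction, which gains at least `L' * δ * ‖α‖` once `s` is large.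
-/
theorem exists_mem_otBall_lt_integral_of_lipschitz [NormedAddCommGroup T] [NormedSpace ℝ T]
    [FiniteDimensional ℝ T] {ℓ : ℝ → T → ℝ}
    (hconv : ConvexOn ℝ univ (fun x : ℝ × T => ℓ x.1 x.2))
    (y : Fin N → E) {p : Fin N → ℝ} (hp : p ∈ stdSimplex ℝ (Fin N)) {δ : ℝ} (hδ : 0 ≤ δ)
    (α : StrongDual ℝ E) (t : T) {c : ℝ}
    (hc : c < ∑ i, p i * ℓ (α (y i)) t + (uniformLip ℓ : ℝ) * δ * ‖α‖) :
    ∃ Q ∈ otBall (fun y₁ y₂ : E => ‖y₁ - y₂‖) δ (discreteLaw y p),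
      c < ∫ u, ℓ (α u) t ∂Q := by
  have hD : ∀ u v : E, 0 ≤ (fun y₁ y₂ : E => ‖y₁ - y₂‖) u v := fun u v => norm_nonneg _
  have hD0 : ∀ u : E, (fun y₁ y₂ : E => ‖y₁ - y₂‖) u u = 0 := fun u => by simp
  rw [mul_assoc] at hc
  rcases (mul_nonneg hδ (norm_nonneg α)).eq_or_lt with hB | hB
  · refine ⟨_, discreteLaw_mem_otBall_self hD hD0 y hp hδ, ?_⟩
    rw [integral_discreteLaw y hp.1]
    simpa [← hB] using hc
  have hα : 0 < ‖α‖ := pos_of_mul_pos_right hB hδ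
  obtain ⟨σ, hσ, hslope⟩ := exists_direction_slope hconv
  obtain ⟨L', hL'1, hL'⟩ : ∃ L', (c - ∑ i, p i * ℓ (α (y i)) t) / (δ * ‖α‖) < L' ∧
      L' < uniformLip ℓ := exists_between (by rw [div_lt_iff₀ hB]; linarith)
  rw [div_lt_iff₀ hB] at hL'1
  choose s₀ hs₀ hs using fun i => hslope (α (y i)) t L' hL'
  -- Beyond every threshold `s₀ i`, and large enough for the moved fraction to be at most one.
  set s := δ * ‖α‖ + ∑ i, s₀ i with hsdef
  have hsum0 : 0 ≤ ∑ i, s₀ i := Finset.sum_nonneg fun i _ => (hs₀ i).le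
  have hspos : 0 < s := by linarith
  have hsi : ∀ i, s₀ i ≤ s := fun i => by
    have := Finset.single_le_sum (fun j _ => (hs₀ j).le) (Finset.mem_univ i)
    linarith
  obtain ⟨u, hu, hαu⟩ := exists_norm_le_one_apply_eq_norm α
  obtain ⟨Q, hQ, hQint⟩ := exists_mem_otBall_integral_eq hD hD0
    (fun i => y i + (s / ‖α‖ * σ) • u) y hp (δ := δ) (ε := δ * ‖α‖ / s) (by positivity)
    ((div_le_one hspos).2 (by linarith)) (by
      have h1 : ‖(s / ‖α‖ * σ) • u‖ ≤ s / ‖α‖ := by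
        rw [norm_smul, norm_mul, Real.norm_eq_abs σ, hσ, mul_one, Real.norm_of_nonneg
          (by positivity)]
        exact mul_le_of_le_one_right (by positivity) hu
      simp only [add_sub_cancel_left, ← Finset.sum_mul, hp.2, one_mul]
      calc _ ≤ δ * ‖α‖ / s * (s / ‖α‖) := by gcongr
        _ = δ := by field_simp)
  refine ⟨Q, hQ, ?_⟩
  rw [hQint fun u => ℓ (α u) t]
  have h1 : ∑ i, p i * ℓ (α (y i)) t + L' * s ≤
      ∑ i, p i * ℓ (α (y i + (s / ‖α‖ * σ) • u)) t := by
    have h2 : L' * s = ∑ i, p i * (L' * s) := by rw [← Finset.sum_mul, hp.2, one_mul]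
    rw [h2, ← Finset.sum_add_distrib]
    refine Finset.sum_le_sum fun i _ => ?_
    rw [← mul_add]
    refine mul_le_mul_of_nonneg_left ?_ (hp.1 i)
    have h3 := hs i s (hsi i)
    have h4 : α (y i + (s / ‖α‖ * σ) • u) = α (y i) + s * σ := by
      rw [map_add, map_smul, hαu, smul_eq_mul]
      field_simp
    rwa [h4]
  have h5 := mul_le_mul_of_nonneg_left h1 (show 0 ≤ δ * ‖α‖ / s by positivity)
  have h6 : δ * ‖α‖ / s * (L' * s) = L' * (δ * ‖α‖) := by field_simp
  rw [mul_add, h6] at h5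
  linarith

end LipschitzDuality

/-! ### The reformulations for the ground cost `‖y₁ - y₂‖` -/

theorem supportFn_le_coe_iff {N : ℕ} {S : Set ((Fin N → ℝ) × ℝ)} {v : (Fin N → ℝ) × ℝ} {c : ℝ} :
    supportFn S v ≤ (c : EReal) ↔ ∀ x ∈ S, ∑ i, v.1 i * x.1 i + v.2 * x.2 ≤ c := by
  simp only [supportFn, iSup_le_iff, EReal.coe_le_coe_iff]

theorem sum_mul_mix {N : ℕ} (v v' x : (Fin N → ℝ) × ℝ) (a b : ℝ) :
    ∑ i, (a • v + b • v').1 i * x.1 i + (a • v + b • v').2 * x.2 =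
      a * (∑ i, v.1 i * x.1 i + v.2 * x.2) + b * (∑ i, v'.1 i * x.1 i + v'.2 * x.2) := by
  simp only [Prod.fst_add, Prod.smul_fst, Pi.add_apply, Pi.smul_apply, smul_eq_mul, Prod.snd_add,
    Prod.smul_snd, add_mul, mul_add, Finset.sum_add_distrib, Finset.mul_sum, mul_assoc]
  ring

section Lipschitz

variable {E : Type*} [NormedAddCommGroup E] [NormedSpace ℝ E]
  {N : ℕ} {y : Fin N → E} {V : Set ((Fin N → ℝ) × ℝ)} {T : Type*} {ℓ : ℝ → T → ℝ}
  {A : Set (StrongDual ℝ E)}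

/-- As `p` and `δ` are nonnegative on `Vplus V`, the support function is monotone in `v`, and the
smallest feasible `v` reproduces the robust objective. -/
theorem iInf_robustLip_eq_iInf_feasibleLip (hp : ∀ x ∈ V, x.1 ∈ stdSimplex ℝ (Fin N)) :
    (⨅ α ∈ A, ⨅ t, robustLip y V ℓ α t) =
      ⨅ x ∈ feasibleLip A y ℓ, supportFn (Vplus V) x.2.2 := by
  refine le_antisymm (le_iInf₂ fun x hx => ?_) (le_iInf₂ fun α hα => le_iInf fun t => ?_)
  · refine (iInf₂_le x.1 hx.1).trans ((iInf_le _ x.2.1).trans ?_)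
    refine iSup₂_mono fun w hw => ?_
    rw [EReal.coe_le_coe_iff]
    have h1 : ∑ i, w.1 i * ℓ (x.1 (y i)) x.2.1 ≤ ∑ i, x.2.2.1 i * w.1 i :=
      Finset.sum_le_sum fun i _ => by
        rw [mul_comm]
        exact mul_le_mul_of_nonneg_right (hx.2.1 i) ((hp w hw.1).1 i)
    have h2 := mul_le_mul_of_nonneg_right hx.2.2 hw.2
    linarith
  · refine (iInf₂_le (α, t, (fun i => ℓ (α (y i)) t), (uniformLip ℓ : ℝ) * ‖α‖)
      ⟨hα, fun i => le_rfl, le_rfl⟩).trans ?_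
    refine iSup₂_mono fun w hw => ?_
    rw [EReal.coe_le_coe_iff]
    simp only [mul_comm (w.1 _)]
    linarith

variable [AddCommGroup T] [Module ℝ T]

theorem convex_apply_mix (hconv : ConvexOn ℝ univ (fun x : ℝ × T => ℓ x.1 x.2))
    (α α' : StrongDual ℝ E) (t t' : T) (u : E) {a b : ℝ} (ha : 0 ≤ a) (hb : 0 ≤ b)
    (hab : a + b = 1) :
    ℓ ((a • α + b • α') u) (a • t + b • t') ≤ a * ℓ (α u) t + b * ℓ (α' u) t' := by
  simpa using hconv.2 (mem_univ (α u, t)) (mem_univ (α' u, t')) ha hb hab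

theorem isConvexProgram_feasibleLip (hA : Convex ℝ A)
    (hconv : ConvexOn ℝ univ (fun x : ℝ × T => ℓ x.1 x.2)) :
    IsConvexProgram (feasibleLip A y ℓ) (fun x => supportFn (Vplus V) x.2.2) := by
  have hS : Convex ℝ (feasibleLip A y ℓ) := by
    rintro ⟨α, t, v⟩ ⟨hα, hv, hv2⟩ ⟨α', t', v'⟩ ⟨hα', hv', hv2'⟩ a b ha hb hab
    refine ⟨hA hα hα' ha hb hab, fun i => ?_, ?_⟩
    · refine (convex_apply_mix hconv α α' t t' (y i) ha hb hab).trans ?_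
      simp only [Prod.smul_mk, Prod.mk_add_mk, Prod.fst_add, Prod.smul_fst, Pi.add_apply,
        Pi.smul_apply, smul_eq_mul]
      gcongr
      exacts [hv i, hv' i]
    · simp only [Prod.smul_mk, Prod.mk_add_mk, Prod.snd_add, Prod.smul_snd, smul_eq_mul] at *
      have h1 : ‖a • α + b • α'‖ ≤ a * ‖α‖ + b * ‖α'‖ := by
        refine (norm_add_le _ _).trans_eq ?_
        rw [norm_smul, norm_smul, Real.norm_of_nonneg ha, Real.norm_of_nonneg hb]
      have h2 := mul_le_mul_of_nonneg_left h1 (NNReal.coe_nonneg (uniformLip ℓ))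
      have h3 := mul_le_mul_of_nonneg_left hv2 ha
      have h4 := mul_le_mul_of_nonneg_left hv2' hb
      linarith
  refine ⟨hS, ?_⟩
  rintro ⟨x, c⟩ ⟨hx, hc⟩ ⟨x', c'⟩ ⟨hx', hc'⟩ a b ha hb hab
  refine ⟨hS hx hx' ha hb hab, ?_⟩
  simp only [supportFn_le_coe_iff] at hc hc' ⊢
  intro w hw
  have := sum_mul_mix x.2.2 x'.2.2 w a b
  simp only [Prod.smul_mk, Prod.mk_add_mk, Prod.snd_add, Prod.smul_snd, smul_eq_mul] at this ⊢
  rw [this]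
  gcongr
  exacts [hc w hw, hc' w hw]

end Lipschitz

theorem unionBall_lipschitz {E : Type*} [NormedAddCommGroup E] [NormedSpace ℝ E]
    [FiniteDimensional ℝ E] [MeasurableSpace E] [BorelSpace E] {N : ℕ} (y : Fin N → E)
    (V : Set ((Fin N → ℝ) × ℝ)) (hV : Convex ℝ V) (hp : ∀ x ∈ V, x.1 ∈ stdSimplex ℝ (Fin N))
    {T : Type*} [NormedAddCommGroup T] [NormedSpace ℝ T] [FiniteDimensional ℝ T]
    {ℓ : ℝ → T → ℝ} (hconv : ConvexOn ℝ univ (fun x : ℝ × T => ℓ x.1 x.2))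
    (hlb : ∀ z, LevelBounded (ℓ z)) (hlip : ∃ K : ℝ≥0, ∀ t, LipschitzWith K fun z => ℓ z t) :
    (∀ Q ∈ unionBall (fun y₁ y₂ : E => ‖y₁ - y₂‖) y V, ∀ (α : StrongDual ℝ E) t,
        Integrable (fun u => ℓ (α u) t) Q) ∧
      (∀ α : StrongDual ℝ E, worstCase (fun y₁ y₂ : E => ‖y₁ - y₂‖) y V ℓ α =
        ⨅ t, robustLip y V ℓ α t) ∧
      ∀ A : Set (StrongDual ℝ E), Convex ℝ A → IsConvexProgram (A ×ˢ (univ : Set T))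
        (fun x => robustLip y V ℓ x.1 x.2) := by
  have hint : ∀ Q ∈ unionBall (fun y₁ y₂ : E => ‖y₁ - y₂‖) y V, ∀ (α : StrongDual ℝ E) t,
      Integrable (fun u => ℓ (α u) t) Q := by
    intro Q hQ α t
    simp only [unionBall, mem_iUnion, exists_prop] at hQ
    obtain ⟨x, hx, hQ⟩ := hQ
    exact (integrable_and_integral_le_uniformLip hlip (hp x hx).1 hQ α t).1
  have hrob : ∀ (α : StrongDual ℝ E) t, robustLip y V ℓ α t =
      ⨆ Q ∈ unionBall (fun y₁ y₂ : E => ‖y₁ - y₂‖) y V,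
        ((∫ u, ℓ (α u) t ∂Q : ℝ) : EReal) := by
    intro α t
    exact iSup_Vplus_eq_iSup_unionBall
      (fun x hx Q hQ =>
        (integrable_and_integral_le_uniformLip hlip (hp x hx.1).1 hQ α t).2)
      (fun x hx c hc =>
        exists_mem_otBall_lt_integral_of_lipschitz hconv y (hp x hx.1) hx.2 α t hc)
  refine ⟨hint, fun α => ?_, fun A hA => ?_⟩
  · rw [worstCase_eq_iInf_iSup (fun u v => norm_nonneg _) (fun u => by simp) hV hp hconv hlb hint]
    exact iInf_congr fun t => (hrob α t).symm
  · simp only [hrob]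
    exact isConvexProgram_iSup_integral hA hconv hint

/-! ### Losses that are powers of a distance-like function -/

/-- A nonnegative convex `1`-Lipschitz function on the line that has slope `±1` in one direction
at every point where it does not vanish. -/
structure IsDistLike (f : ℝ → ℝ) : Prop where
  nonneg : ∀ x, 0 ≤ f x
  convexOn : ConvexOn ℝ univ f
  abs_sub_le : ∀ x x', |f x - f x'| ≤ |x - x'|
  -- Coercivity: it gives level boundedness in `t`, and growth with slope one far from points where
  -- `f` vanishes.
  exists_abs_sub_le : ∃ m, ∀ x, |x| - m ≤ f x
  exists_direction : ∀ x, 0 < f x → ∃ σ : ℝ, |σ| = 1 ∧ ∀ d, 0 ≤ d → f x + d ≤ f (x + d * σ)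

theorem exists_direction_abs_sub (b x : ℝ) :
    ∃ σ : ℝ, |σ| = 1 ∧ ∀ d, 0 ≤ d → |x - b| + d ≤ |x + d * σ - b| := by
  rcases le_total b x with h | h
  · refine ⟨1, by simp, fun d hd => ?_⟩
    rw [abs_of_nonneg (sub_nonneg.2 h)]
    exact le_trans (by linarith) (le_abs_self _)
  · refine ⟨-1, by simp, fun d hd => ?_⟩
    rw [abs_of_nonpos (sub_nonpos.2 h)]
    exact le_trans (by linarith) (neg_le_abs _)

theorem convexOn_abs_sub (b : ℝ) : ConvexOn ℝ univ (fun x : ℝ => |x - b|) := by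
  refine ⟨convex_univ, fun x _ x' _ a c ha hc hac => ?_⟩
  have h : a • x + c • x' - b = a * (x - b) + c * (x' - b) := by
    simp only [smul_eq_mul]
    linear_combination b * hac
  change |a • x + c • x' - b| ≤ a * |x - b| + c * |x' - b|
  rw [h]
  refine (abs_add_le _ _).trans_eq ?_
  rw [abs_mul, abs_mul, abs_of_nonneg ha, abs_of_nonneg hc]

theorem abs_abs_sub_abs_le (b x x' : ℝ) : |(|x - b| - |x' - b|)| ≤ |x - x'| := by
  simpa using abs_abs_sub_abs_le_abs_sub (x - b) (x' - b)

theorem isDistLike_max_abs_sub (b₁ b₂ : ℝ) : IsDistLike fun x => max (|x - b₁| - b₂) 0 where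
  nonneg x := le_max_right _ _
  convexOn := ((convexOn_abs_sub b₁).add_const (-b₂)).sup (convexOn_const 0 convex_univ)
  abs_sub_le x x' := by
    refine (abs_max_sub_max_le_abs _ _ _).trans ?_
    rw [sub_sub_sub_cancel_right]
    exact abs_abs_sub_abs_le b₁ x x'
  exists_abs_sub_le := ⟨|b₁| + b₂, fun x => by
    have := abs_sub_abs_le_abs_sub x b₁
    exact le_trans (by linarith) (le_max_left _ _)⟩
  exists_direction x hx := by
    obtain ⟨σ, hσ, h⟩ := exists_direction_abs_sub b₁ x
    refine ⟨σ, hσ, fun d hd => ?_⟩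
    have hx' : 0 < |x - b₁| - b₂ := by
      by_contra! h'
      rw [max_eq_right h'] at hx
      exact lt_irrefl _ hx
    rw [max_eq_left hx'.le]
    exact le_trans (by linarith [h d hd]) (le_max_left _ _)

theorem isDistLike_abs_sub_add (b₁ : ℝ) {b₂ : ℝ} (hb₂ : 0 < b₂) :
    IsDistLike fun x => |x - b₁| + b₂ where
  nonneg x := by positivity
  convexOn := (convexOn_abs_sub b₁).add_const b₂
  abs_sub_le x x' := by
    rw [add_sub_add_right_eq_sub]
    exact abs_abs_sub_abs_le b₁ x x'
  exists_abs_sub_le := ⟨|b₁|, fun x => by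
    have := abs_sub_abs_le_abs_sub x b₁
    linarith⟩
  exists_direction x _ := by
    obtain ⟨σ, hσ, h⟩ := exists_direction_abs_sub b₁ x
    exact ⟨σ, hσ, fun d hd => by linarith [h d hd]⟩

theorem rpow_mix_le {q : ℝ} (hq : 1 ≤ q) {x x' c a b : ℝ} (hx : 0 ≤ x) (hx' : 0 ≤ x')
    (ha : 0 ≤ a) (hb : 0 ≤ b) (hab : a + b = 1) (hc0 : 0 ≤ c) (hc : c ≤ a * x + b * x') :
    c ^ q ≤ a * x ^ q + b * x' ^ q :=
  (Real.rpow_le_rpow hc0 hc (by linarith)).trans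
    ((convexOn_rpow hq).2 (mem_Ici.2 hx) (mem_Ici.2 hx') ha hb hab)

section Loss

variable {ℓbar : ℝ → ℝ} (hℓ : IsDistLike ℓbar) {q C : ℝ}
include hℓ

theorem IsDistLike.apply_sub_mix_le (z z' t t' : ℝ) {a b : ℝ} (ha : 0 ≤ a) (hb : 0 ≤ b)
    (hab : a + b = 1) :
    ℓbar ((a * z + b * z') - (a * t + b * t')) ≤ a * ℓbar (z - t) + b * ℓbar (z' - t') := by
  have := hℓ.convexOn.2 (mem_univ (z - t)) (mem_univ (z' - t')) ha hb hab
  simp only [smul_eq_mul] at this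
  rwa [show a * z + b * z' - (a * t + b * t') = a * (z - t) + b * (z' - t') by ring]

theorem IsDistLike.convexOn_rpow_loss (hq : 1 ≤ q) (hC : 0 ≤ C) :
    ConvexOn ℝ univ (fun x : ℝ × ℝ => (C * ℓbar (x.1 - x.2)) ^ q) := by
  refine ⟨convex_univ, fun x _ x' _ a b ha hb hab => ?_⟩
  refine rpow_mix_le hq (mul_nonneg hC (hℓ.nonneg _)) (mul_nonneg hC (hℓ.nonneg _)) ha hb hab
    (mul_nonneg hC (hℓ.nonneg _)) ?_
  have := mul_le_mul_of_nonneg_left (hℓ.apply_sub_mix_le x.1 x'.1 x.2 x'.2 ha hb hab) hC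
  simp only [Prod.fst_add, Prod.smul_fst, Prod.snd_add, Prod.smul_snd, smul_eq_mul]
  linarith

theorem IsDistLike.levelBounded_rpow_loss (hq : 0 < q) (hC : 0 < C) (z : ℝ) :
    LevelBounded (fun t : ℝ => (C * ℓbar (z - t)) ^ q) := by
  intro a
  obtain ⟨m, hm⟩ := hℓ.exists_abs_sub_le
  refine (Metric.isBounded_closedBall (x := z) (r := (max a 0) ^ (1 / q) / C + m)).subset ?_
  intro t ht
  simp only [mem_ofPred_eq] at ht
  rw [Metric.mem_closedBall, Real.dist_eq, abs_sub_comm]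
  have h0 : 0 ≤ C * ℓbar (z - t) := mul_nonneg hC.le (hℓ.nonneg _)
  have h1 : C * ℓbar (z - t) ≤ (max a 0) ^ (1 / q) := by
    have := Real.rpow_le_rpow (by positivity) (ht.trans (le_max_left a 0))
      (one_div_nonneg.2 hq.le)
    rwa [← Real.rpow_mul h0, mul_one_div_cancel hq.ne', Real.rpow_one] at this
  have h2 : ℓbar (z - t) ≤ (max a 0) ^ (1 / q) / C := by
    rw [le_div_iff₀ hC]
    linarith
  linarith [hm (z - t)]

end Loss

theorem norm_mul_smul_le {E : Type*} [NormedAddCommGroup E] [NormedSpace ℝ E] {u : E}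
    (hu : ‖u‖ ≤ 1) {d σ : ℝ} (hd : 0 ≤ d) (hσ : |σ| = 1) : ‖(d * σ) • u‖ ≤ d := by
  rw [norm_smul, norm_mul, Real.norm_eq_abs σ, hσ, mul_one, Real.norm_of_nonneg hd]
  exact mul_le_of_le_one_right hd hu

/-! ### Worst case over one ball for the cost `‖y₁ - y₂‖ ^ q`. -/

section Pow

variable {E : Type*} [NormedAddCommGroup E] [NormedSpace ℝ E] [FiniteDimensional ℝ E]
  [MeasurableSpace E] [BorelSpace E] {N : ℕ} {q : ℝ}

/-- Minkowski's inequality in `L^q` of a coupling, applied to `h z.1 ≤ h z.2 + K * ‖z.1 - z.2‖`.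
Lower integrals are used so that integrability comes out as a result. -/
theorem integrable_and_integral_rpow_le (hq : 1 < q) {h : E → ℝ} (h0 : ∀ u, 0 ≤ h u) {K : ℝ}
    (hK : 0 ≤ K) (hh : ∀ u v, |h u - h v| ≤ K * ‖u - v‖)
    {y : Fin N → E} {p : Fin N → ℝ} (hp : ∀ i, 0 ≤ p i) {δ : ℝ} {Q : Measure E}
    (hQ : Q ∈ otBall (fun y₁ y₂ : E => ‖y₁ - y₂‖ ^ q) δ (discreteLaw y p)) :
    Integrable (fun u => h u ^ q) Q ∧
      ∫ u, h u ^ q ∂Q ≤ ((∑ i, p i * h (y i) ^ q) ^ (1 / q) + K * δ ^ (1 / q)) ^ q := by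
  have : ProperSpace E := FiniteDimensional.proper ℝ E
  have hδ := nonneg_of_mem_otBall hQ
  have hq0 : 0 < q := by linarith
  have hcont : Continuous h := by
    refine (LipschitzWith.of_dist_le_mul (K := K.toNNReal) fun u v => ?_).continuous
    rw [Real.coe_toNNReal _ hK, Real.dist_eq, dist_eq_norm]
    exact hh u v
  have hmeas : Measurable h := hcont.measurable
  have hmq : Measurable fun u => h u ^ q := hmeas.pow_const q
  have hS : 0 ≤ ∑ i, p i * h (y i) ^ q :=
    Finset.sum_nonneg fun i _ => mul_nonneg (hp i) (Real.rpow_nonneg (h0 _) _)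
  have key : ∀ δ' > δ, Integrable (fun u => h u ^ q) Q ∧
      ∫ u, h u ^ q ∂Q ≤ ((∑ i, p i * h (y i) ^ q) ^ (1 / q) + K * δ' ^ (1 / q)) ^ q := by
    intro δ' hδ'
    have hδ'0 : 0 ≤ δ' := hδ.trans hδ'.le
    obtain ⟨π, ⟨hf, hs⟩, hc⟩ := exists_coupling_of_mem_otBall hQ hδ'
    have e1 : ∫⁻ u, ENNReal.ofReal (h u ^ q) ∂Q = ∫⁻ z, ENNReal.ofReal (h z.1) ^ q ∂π := by
      rw [← hf, lintegral_map hmq.ennreal_ofReal measurable_fst]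
      simp only [ENNReal.ofReal_rpow_of_nonneg (h0 _) hq0.le]
    have e2 : ∫⁻ z, ENNReal.ofReal (h z.2) ^ q ∂π =
        ENNReal.ofReal (∑ i, p i * h (y i) ^ q) := by
      simp only [ENNReal.ofReal_rpow_of_nonneg (h0 _) hq0.le]
      rw [← lintegral_map hmq.ennreal_ofReal measurable_snd, hs, lintegral_discreteLaw,
        ENNReal.ofReal_sum_of_nonneg fun i _ => mul_nonneg (hp i) (Real.rpow_nonneg (h0 _) _)]
      simp only [ENNReal.ofReal_mul (hp _)]
    have e3 : ∫⁻ z, ENNReal.ofReal (K * ‖z.1 - z.2‖) ^ q ∂π ≤ ENNReal.ofReal (K ^ q * δ') := by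
      have : ∀ z : E × E, ENNReal.ofReal (K * ‖z.1 - z.2‖) ^ q =
          ENNReal.ofReal (K ^ q) * ENNReal.ofReal (‖z.1 - z.2‖ ^ q) := fun z => by
        rw [ENNReal.ofReal_rpow_of_nonneg (by positivity) hq0.le,
          Real.mul_rpow hK (norm_nonneg _), ENNReal.ofReal_mul (by positivity)]
      simp only [this]
      rw [lintegral_const_mul' _ _ ENNReal.ofReal_ne_top, ENNReal.ofReal_mul (by positivity)]
      gcongr
    have e4 : (∫⁻ u, ENNReal.ofReal (h u ^ q) ∂Q) ^ (1 / q) ≤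
        ENNReal.ofReal ((∑ i, p i * h (y i) ^ q) ^ (1 / q) + K * δ' ^ (1 / q)) := by
      calc _ ≤ (∫⁻ z, ((fun z : E × E => ENNReal.ofReal (h z.2)) +
            fun z : E × E => ENNReal.ofReal (K * ‖z.1 - z.2‖)) z ^ q ∂π) ^ (1 / q) := by
            rw [e1]
            gcongr with z
            rw [Pi.add_apply, ← ENNReal.ofReal_add (h0 _) (by positivity)]
            refine ENNReal.ofReal_le_ofReal ?_
            linarith [(abs_le.1 (hh z.1 z.2)).2]
        _ ≤ (∫⁻ z, ENNReal.ofReal (h z.2) ^ q ∂π) ^ (1 / q) +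
            (∫⁻ z, ENNReal.ofReal (K * ‖z.1 - z.2‖) ^ q ∂π) ^ (1 / q) :=
            ENNReal.lintegral_Lp_add_le (hmeas.comp measurable_snd).ennreal_ofReal.aemeasurable
              ((measurable_fst.sub measurable_snd).norm.const_mul K).ennreal_ofReal.aemeasurable
              hq.le
        _ ≤ ENNReal.ofReal (∑ i, p i * h (y i) ^ q) ^ (1 / q) +
            ENNReal.ofReal (K ^ q * δ') ^ (1 / q) := by
            rw [e2]
            gcongr
        _ = _ := by
            rw [ENNReal.ofReal_rpow_of_nonneg hS (by positivity),
              ENNReal.ofReal_rpow_of_nonneg (by positivity) (by positivity),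
              Real.mul_rpow (by positivity) hδ'0, ← Real.rpow_mul hK,
              mul_one_div_cancel hq0.ne', Real.rpow_one,
              ← ENNReal.ofReal_add (by positivity) (by positivity)]
    have e5 : ∫⁻ u, ENNReal.ofReal (h u ^ q) ∂Q ≤
        ENNReal.ofReal (((∑ i, p i * h (y i) ^ q) ^ (1 / q) + K * δ' ^ (1 / q)) ^ q) := by
      rw [← ENNReal.ofReal_rpow_of_nonneg (by positivity) hq0.le]
      have := ENNReal.rpow_le_rpow e4 hq0.le
      rwa [← ENNReal.rpow_mul, one_div_mul_cancel hq0.ne', ENNReal.rpow_one] at this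
    have hnn : ∀ u, 0 ≤ h u ^ q := fun u => Real.rpow_nonneg (h0 u) q
    refine ⟨⟨hmq.aestronglyMeasurable, ?_⟩, ?_⟩
    · rw [hasFiniteIntegral_iff_ofReal (Filter.Eventually.of_forall hnn)]
      exact e5.trans_lt ENNReal.ofReal_lt_top
    · rw [integral_eq_lintegral_of_nonneg_ae (Filter.Eventually.of_forall hnn)
        hmq.aestronglyMeasurable]
      exact ENNReal.toReal_le_of_le_ofReal (by positivity) e5
  refine ⟨(key (δ + 1) (by linarith)).1, ?_⟩
  refine le_of_forall_gt_of_continuousAt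
    (Φ := fun δ' => ((∑ i, p i * h (y i) ^ q) ^ (1 / q) + K * δ' ^ (1 / q)) ^ q) ?_
    fun δ' hδ' => (key δ' hδ').2
  refine Continuous.continuousAt ?_
  exact (continuous_const.add (continuous_const.mul
    (continuous_id.rpow_const fun _ => Or.inr (by positivity)))).rpow_const
      fun _ => Or.inr hq0.le

theorem exists_mem_otBall_lt_integral_rpow (hq : 1 < q) {C : ℝ} (hC : 0 < C) {ℓbar : ℝ → ℝ}
    (hℓ : IsDistLike ℓbar) (y : Fin N → E) {p : Fin N → ℝ} (hp : p ∈ stdSimplex ℝ (Fin N))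
    {δ : ℝ} (hδ : 0 ≤ δ) (α : StrongDual ℝ E) (t : ℝ) {c : ℝ}
    (hc : c < ((∑ i, p i * (C * ℓbar (α (y i) - t)) ^ q) ^ (1 / q) +
      C * δ ^ (1 / q) * ‖α‖) ^ q) :
    ∃ Q ∈ otBall (fun y₁ y₂ : E => ‖y₁ - y₂‖ ^ q) δ (discreteLaw y p),
      c < ∫ u, (C * ℓbar (α u - t)) ^ q ∂Q := by
  have hq0 : 0 < q := by linarith
  have hD : ∀ u v : E, 0 ≤ (fun y₁ y₂ : E => ‖y₁ - y₂‖ ^ q) u v := fun u v => by positivity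
  have hD0 : ∀ u : E, (fun y₁ y₂ : E => ‖y₁ - y₂‖ ^ q) u u = 0 := fun u => by
    simp [hq0.ne']
  obtain ⟨u, hu, hαu⟩ := exists_norm_le_one_apply_eq_norm α
  have ha : ∀ i, 0 ≤ C * ℓbar (α (y i) - t) := fun i => mul_nonneg hC.le (hℓ.nonneg _)
  have hterm : ∀ i, 0 ≤ p i * (C * ℓbar (α (y i) - t)) ^ q := fun i =>
    mul_nonneg (hp.1 i) (Real.rpow_nonneg (ha i) q)
  have hcancel : ∀ x : ℝ, 0 ≤ x → (x ^ (1 / q)) ^ q = x := fun x hx => by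
    rw [← Real.rpow_mul hx, one_div_mul_cancel hq0.ne', Real.rpow_one]
  -- With zero expected loss no displacement proportional to the loss is available. Instead the mass
  -- `η ^ q` moves by at most `δ ^ (1 / q) / η`, at cost at most `δ`, and `η → 0`.
  rcases (Finset.sum_nonneg fun i (_ : i ∈ Finset.univ) => hterm i).eq_or_lt with hS | hS
  · rw [← hS, Real.zero_rpow (by positivity), zero_add] at hc
    obtain ⟨m, hm⟩ := hℓ.exists_abs_sub_le
    -- One offset for all atoms: after a shift of `α` by `d`, `ℓbar` is at least `d - m'`. Its
    -- contribution `C * m' * η` disappears in the limit.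
    set m' := m + ∑ i, |α (y i) - t| with hm'
    have hcontη : Continuous fun η : ℝ => (max (C * δ ^ (1 / q) * ‖α‖ - C * m' * η) 0) ^ q :=
      Continuous.rpow_const (by fun_prop) fun _ => Or.inr hq0.le
    have hev : ∀ᶠ η in nhdsWithin (0 : ℝ) (Ioi 0),
        c < (max (C * δ ^ (1 / q) * ‖α‖ - C * m' * η) 0) ^ q := by
      refine nhdsWithin_le_nhds (hcontη.continuousAt.eventually_const_lt ?_)
      simpa only [mul_zero, sub_zero, max_eq_left (show 0 ≤ C * δ ^ (1 / q) * ‖α‖ by positivity)]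
        using hc
    obtain ⟨η, hη, hη0, hη1⟩ := (hev.and (Ioo_mem_nhdsGT (zero_lt_one' ℝ))).exists
    obtain ⟨Q, hQ, hQint⟩ := exists_mem_otBall_integral_eq hD hD0
      (fun i => y i + (δ ^ (1 / q) / η * 1) • u) y hp (δ := δ) (ε := η ^ q) (by positivity)
      (Real.rpow_le_one hη0.le hη1.le hq0.le) (by
        simp only [add_sub_cancel_left, ← Finset.sum_mul, hp.2, one_mul]
        calc _ ≤ η ^ q * (δ ^ (1 / q) / η) ^ q := by
              gcongr
              exact norm_mul_smul_le hu (by positivity) abs_one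
          _ = δ := by
              rw [← Real.mul_rpow hη0.le (by positivity), mul_div_cancel₀ _ hη0.ne',
                hcancel δ hδ])
    refine ⟨Q, hQ, hη.trans_le ?_⟩
    rw [hQint fun u => (C * ℓbar (α u - t)) ^ q, ← hS, mul_zero, zero_add]
    have h1 : ∀ i, (max (C * δ ^ (1 / q) * ‖α‖ - C * m' * η) 0) ^ q ≤
        η ^ q * (C * ℓbar (α (y i + (δ ^ (1 / q) / η * 1) • u) - t)) ^ q := by
      intro i
      have hnn : 0 ≤ C * ℓbar (α (y i + (δ ^ (1 / q) / η * 1) • u) - t) :=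
        mul_nonneg hC.le (hℓ.nonneg _)
      rw [← Real.mul_rpow hη0.le hnn]
      refine Real.rpow_le_rpow (le_max_right _ _) (max_le ?_ (by positivity)) hq0.le
      have h2 := hm (α (y i + (δ ^ (1 / q) / η * 1) • u) - t)
      rw [map_add, map_smul, hαu, smul_eq_mul, mul_one] at h2 ⊢
      have h3 := Finset.single_le_sum (f := fun i => |α (y i) - t|)
        (fun j _ => abs_nonneg _) (Finset.mem_univ i)
      have h4 := neg_abs_le (α (y i) - t)
      have h5 := le_abs_self (α (y i) + δ ^ (1 / q) / η * ‖α‖ - t)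
      have h6 : δ ^ (1 / q) / η * ‖α‖ - m' ≤ ℓbar (α (y i) + δ ^ (1 / q) / η * ‖α‖ - t) := by
        linarith
      have h7 := mul_le_mul_of_nonneg_left h6 (mul_nonneg hη0.le hC.le)
      have h8 : η * C * (δ ^ (1 / q) / η * ‖α‖ - m') =
          C * δ ^ (1 / q) * ‖α‖ - C * m' * η := by field_simp
      linarith
    rw [Finset.mul_sum]
    calc _ = ∑ i, p i * (max (C * δ ^ (1 / q) * ‖α‖ - C * m' * η) 0) ^ q := by
          rw [← Finset.sum_mul, hp.2, one_mul]
      _ ≤ _ := Finset.sum_le_sum fun i _ => by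
          rw [mul_left_comm]
          exact mul_le_mul_of_nonneg_left (h1 i) (hp.1 i)
  · set S := ∑ i, p i * (C * ℓbar (α (y i) - t)) ^ q with hSdef
    have hdir : ∀ i, ∃ σ : ℝ, |σ| = 1 ∧ (0 < ℓbar (α (y i) - t) → ∀ d, 0 ≤ d →
        ℓbar (α (y i) - t) + d ≤ ℓbar (α (y i) - t + d * σ)) := by
      intro i
      by_cases h : 0 < ℓbar (α (y i) - t)
      · obtain ⟨σ, hσ, h'⟩ := hℓ.exists_direction _ h
        exact ⟨σ, hσ, fun _ => h'⟩
      · exact ⟨1, by simp, fun h' => absurd h' h⟩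
    choose σ hσ hσd using hdir
    -- Proportional to the loss and scaled so that `∑ i, p i * d i ^ q = δ`. Atoms without loss stay
    -- put, so their direction is irrelevant; all losses grow by at least one common factor.
    set d : Fin N → ℝ := fun i => C * ℓbar (α (y i) - t) * (δ ^ (1 / q) / S ^ (1 / q)) with hd
    have hd0 : ∀ i, 0 ≤ d i := fun i => mul_nonneg (ha i) (by positivity)
    obtain ⟨Q, hQ, hQint⟩ := exists_mem_otBall_integral_eq hD hD0
      (fun i => y i + (d i * σ i) • u) y hp (δ := δ) (ε := 1) zero_le_one le_rfl (by
        simp only [add_sub_cancel_left, one_mul]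
        calc _ ≤ ∑ i, p i * d i ^ q := by
              refine Finset.sum_le_sum fun i _ => mul_le_mul_of_nonneg_left ?_ (hp.1 i)
              exact Real.rpow_le_rpow (norm_nonneg _) (norm_mul_smul_le hu (hd0 i) (hσ i)) hq0.le
          _ = S * (δ ^ (1 / q) / S ^ (1 / q)) ^ q := by
              rw [hSdef, Finset.sum_mul]
              refine Finset.sum_congr rfl fun i _ => ?_
              rw [hd, Real.mul_rpow (ha i) (by positivity), mul_assoc]
          _ = δ := by
              rw [Real.div_rpow (by positivity) (by positivity), hcancel δ hδ, hcancel S hS.le,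
                mul_div_cancel₀ _ hS.ne'])
    refine ⟨Q, hQ, hc.trans_le ?_⟩
    rw [hQint fun u => (C * ℓbar (α u - t)) ^ q, sub_self, zero_mul, zero_add, one_mul]
    have h1 : ∀ i, C * ℓbar (α (y i) - t) * (1 + C * ‖α‖ * (δ ^ (1 / q) / S ^ (1 / q))) ≤
        C * ℓbar (α (y i + (d i * σ i) • u) - t) := by
      intro i
      rw [map_add, map_smul, hαu, smul_eq_mul]
      rcases (hℓ.nonneg (α (y i) - t)).eq_or_lt with h | h
      · rw [← h, mul_zero, zero_mul]
        exact mul_nonneg hC.le (hℓ.nonneg _)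
      · have h2 := mul_le_mul_of_nonneg_left
          (hσd i h (d i * ‖α‖) (mul_nonneg (hd0 i) (norm_nonneg _))) hC.le
        have h3 : α (y i) - t + d i * ‖α‖ * σ i = α (y i) + d i * σ i * ‖α‖ - t := by ring
        rw [h3] at h2
        refine le_trans (le_of_eq ?_) h2
        simp only [hd]
        ring
    have hfac : 0 ≤ 1 + C * ‖α‖ * (δ ^ (1 / q) / S ^ (1 / q)) := by positivity
    calc _ = S * (1 + C * ‖α‖ * (δ ^ (1 / q) / S ^ (1 / q))) ^ q := by
          have h2 : S ^ (1 / q) + C * δ ^ (1 / q) * ‖α‖ =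
              S ^ (1 / q) * (1 + C * ‖α‖ * (δ ^ (1 / q) / S ^ (1 / q))) := by field_simp
          rw [h2, Real.mul_rpow (by positivity) hfac, hcancel S hS.le]
      _ = ∑ i, p i *
          (C * ℓbar (α (y i) - t) * (1 + C * ‖α‖ * (δ ^ (1 / q) / S ^ (1 / q)))) ^ q := by
          rw [hSdef, Finset.sum_mul]
          refine Finset.sum_congr rfl fun i _ => ?_
          rw [Real.mul_rpow (ha i) hfac, mul_assoc]
      _ ≤ _ := Finset.sum_le_sum fun i _ => mul_le_mul_of_nonneg_left
          (Real.rpow_le_rpow (mul_nonneg (ha i) hfac) (h1 i) hq0.le) (hp.1 i)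

theorem unionBall_rpow (hq : 1 < q) {C : ℝ} (hC : 0 < C) {ℓbar : ℝ → ℝ}
    (hℓ : IsDistLike ℓbar) (y : Fin N → E) (V : Set ((Fin N → ℝ) × ℝ)) (hV : Convex ℝ V)
    (hp : ∀ x ∈ V, x.1 ∈ stdSimplex ℝ (Fin N)) :
    (∀ Q ∈ unionBall (fun y₁ y₂ : E => ‖y₁ - y₂‖ ^ q) y V, ∀ (α : StrongDual ℝ E) t,
        Integrable (fun u => (C * ℓbar (α u - t)) ^ q) Q) ∧
      (∀ α : StrongDual ℝ E,
        worstCase (fun y₁ y₂ : E => ‖y₁ - y₂‖ ^ q) y V (fun z t => (C * ℓbar (z - t)) ^ q) α =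
          ⨅ t, robustPow q C y V (fun z t => (C * ℓbar (z - t)) ^ q) α t) ∧
      ∀ A : Set (StrongDual ℝ E), Convex ℝ A → IsConvexProgram (A ×ˢ (univ : Set ℝ))
        (fun x => robustPow q C y V (fun z t => (C * ℓbar (z - t)) ^ q) x.1 x.2) := by
  have hq0 : 0 < q := by linarith
  have hupper : ∀ x ∈ V, ∀ Q ∈ otBall (fun y₁ y₂ : E => ‖y₁ - y₂‖ ^ q) x.2 (discreteLaw y x.1),
      ∀ (α : StrongDual ℝ E) t, Integrable (fun u => (C * ℓbar (α u - t)) ^ q) Q ∧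
        ∫ u, (C * ℓbar (α u - t)) ^ q ∂Q ≤
          ((∑ i, x.1 i * (C * ℓbar (α (y i) - t)) ^ q) ^ (1 / q) +
            C * x.2 ^ (1 / q) * ‖α‖) ^ q := by
    intro x hx Q hQ α t
    have h := integrable_and_integral_rpow_le hq (h := fun u => C * ℓbar (α u - t))
      (fun u => mul_nonneg hC.le (hℓ.nonneg _)) (K := C * ‖α‖) (by positivity) (fun u v => by
        rw [← mul_sub, abs_mul, abs_of_pos hC, mul_assoc]
        refine mul_le_mul_of_nonneg_left ((hℓ.abs_sub_le _ _).trans ?_) hC.le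
        rw [sub_sub_sub_cancel_right, ← map_sub]
        exact α.le_opNorm _) (hp x hx).1 hQ
    rwa [mul_right_comm] at h
  have hint : ∀ Q ∈ unionBall (fun y₁ y₂ : E => ‖y₁ - y₂‖ ^ q) y V, ∀ (α : StrongDual ℝ E) t,
      Integrable (fun u => (C * ℓbar (α u - t)) ^ q) Q := by
    intro Q hQ α t
    simp only [unionBall, mem_iUnion, exists_prop] at hQ
    obtain ⟨x, hx, hQ⟩ := hQ
    exact (hupper x hx Q hQ α t).1
  have hrob : ∀ (α : StrongDual ℝ E) t,
      robustPow q C y V (fun z t => (C * ℓbar (z - t)) ^ q) α t =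
        ⨆ Q ∈ unionBall (fun y₁ y₂ : E => ‖y₁ - y₂‖ ^ q) y V,
          ((∫ u, (C * ℓbar (α u - t)) ^ q ∂Q : ℝ) : EReal) := by
    intro α t
    exact iSup_Vplus_eq_iSup_unionBall
      (fun x hx Q hQ => (hupper x hx.1 Q hQ α t).2)
      (fun x hx c hc =>
        exists_mem_otBall_lt_integral_rpow hq hC hℓ y (hp x hx.1) hx.2 α t hc)
  have hconv := hℓ.convexOn_rpow_loss hq.le hC.le
  refine ⟨hint, fun α => ?_, fun A hA => ?_⟩
  · rw [worstCase_eq_iInf_iSup (fun u v => by positivity) (fun u => by simp [hq0.ne']) hV hp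
      (ℓ := fun z t => (C * ℓbar (z - t)) ^ q) hconv
      (fun z => hℓ.levelBounded_rpow_loss hq0 hC z) hint]
    exact iInf_congr fun t => (hrob α t).symm
  · simp only [hrob]
    exact isConvexProgram_iSup_integral (ℓ := fun z t => (C * ℓbar (z - t)) ^ q) hA hconv hint

end Pow

/-! ### The conic program for the ground cost `‖y₁ - y₂‖ ^ q` -/

section Scalar

variable {q : ℝ}

/-- The number `β = q ^ (1 / (1 - q))` normalizes the conic program: `x ^ q / s ^ (q - 1) + constOne
q * s` is minimal at `s = x / β`, with value `x`. -/
theorem mul_rpow_sub_one_eq_one (hq : 1 < q) : q * (q ^ (1 / (1 - q))) ^ (q - 1) = 1 := by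
  have h1 : 1 - q ≠ 0 := by linarith
  rw [← Real.rpow_mul (by linarith), show 1 / (1 - q) * (q - 1) = -1 by field_simp; ring,
    Real.rpow_neg_one, mul_inv_cancel₀ (by linarith)]

theorem constOne_eq (hq : 1 < q) : constOne q = (q - 1) * (q ^ (1 / (1 - q))) ^ q := by
  have h1 : 1 - q ≠ 0 := by linarith
  have hq0 : 0 < q := by linarith
  have h2 : q ^ (1 / (1 - q)) = q * q ^ (q / (1 - q)) := by
    conv_rhs => rw [← Real.rpow_one_add' hq0.le (by field_simp; norm_num; exact h1)]
    congr 1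
    field_simp
    ring
  have h3 : (q ^ (1 / (1 - q))) ^ q = q ^ (q / (1 - q)) := by
    rw [← Real.rpow_mul hq0.le, one_div_mul_eq_div]
  rw [constOne, h3, h2]
  ring

theorem constOne_pos (hq : 1 < q) : 0 < constOne q := by
  rw [constOne_eq hq]
  have : 0 < q - 1 := by linarith
  have : 0 < q := by linarith
  positivity

theorem constTwo_eq (q C : ℝ) : constTwo q C = C ^ (q / (q - 1)) * constOne q := rfl

theorem constTwo_pos (hq : 1 < q) {C : ℝ} (hC : 0 < C) : 0 < constTwo q C := by
  rw [constTwo_eq]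
  exact mul_pos (Real.rpow_pos_of_pos hC _) (constOne_pos hq)

/-- Young's inequality, read as: `x ^ q` lies above its tangent at `b`. -/
theorem mul_mul_rpow_sub_one_le (hq : 1 < q) {x b : ℝ} (hx : 0 ≤ x) (hb : 0 ≤ b) :
    q * x * b ^ (q - 1) ≤ x ^ q + (q - 1) * b ^ q := by
  have hq1 : 0 < q - 1 := by linarith
  have hq0 : 0 < q := by linarith
  have h := Real.young_inequality_of_nonneg hx (Real.rpow_nonneg hb (q - 1))
    (Real.HolderConjugate.conjExponent hq)
  have h1 : (b ^ (q - 1)) ^ q.conjExponent = b ^ q := by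
    rw [← Real.rpow_mul hb, Real.conjExponent, mul_div_cancel₀ _ hq1.ne']
  rw [h1, Real.conjExponent] at h
  have h2 := mul_le_mul_of_nonneg_left h hq0.le
  have h3 : q * (x ^ q / q + b ^ q / (q / (q - 1))) = x ^ q + (q - 1) * b ^ q := by
    field_simp
  linarith

theorem div_rpow_sub_one_eq {a s : ℝ} (ha : 0 ≤ a) (hs : 0 < s) :
    a ^ q / s ^ (q - 1) = s * (a / s) ^ q := by
  rw [Real.div_rpow ha hs.le, Real.rpow_sub_one hs.ne']
  field_simp

theorem ratio_of_pos {a s : ℝ} (hs : 0 < s) : ratio q a s = ((a / s ^ (q - 1) : ℝ) : EReal) := by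
  rw [ratio, if_neg hs.ne']

/-- The epigraph of the perspective function is an intersection of half-spaces. -/
theorem ratio_rpow_le_iff (hq : 1 < q) {a s v : ℝ} (ha : 0 ≤ a) (hs : 0 ≤ s) :
    ratio q (a ^ q) s ≤ (v : EReal) ↔
      ∀ b, 0 ≤ b → q * a * b ^ (q - 1) - (q - 1) * s * b ^ q ≤ v := by
  have hq0 : 0 < q := by linarith
  have hq1 : 0 < q - 1 := by linarith
  rcases hs.eq_or_lt with rfl | hs
  · rcases ha.eq_or_lt with rfl | ha
    · rw [ratio, if_pos rfl, Real.zero_rpow hq0.ne', if_pos rfl]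
      simp only [mul_zero, zero_mul, sub_zero, EReal.coe_nonneg]
      exact ⟨fun h _ _ => h, fun h => h 0 le_rfl⟩
    · rw [ratio, if_pos rfl, if_neg (Real.rpow_pos_of_pos ha q).ne']
      refine ⟨fun h => absurd h (not_le.2 (EReal.coe_lt_top v)), fun h => ?_⟩
      exfalso
      -- At `s = 0` this `b` makes the left side `|v| + 1`, so no finite `v` is feasible.
      have h1 := h (((|v| + 1) / (q * a)) ^ (1 / (q - 1))) (by positivity)
      rw [← Real.rpow_mul (by positivity), one_div_mul_cancel hq1.ne', Real.rpow_one,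
        mul_div_cancel₀ _ (by positivity)] at h1
      linarith [le_abs_self v]
  · rw [ratio_of_pos hs, EReal.coe_le_coe_iff, div_rpow_sub_one_eq ha hs]
    refine ⟨fun h b hb => le_trans ?_ h, fun h => le_trans (le_of_eq ?_) (h (a / s) (by positivity))⟩
    · have h1 := mul_le_mul_of_nonneg_left
        (mul_mul_rpow_sub_one_le hq (div_nonneg ha hs.le) hb) hs.le
      have h2 : s * (q * (a / s) * b ^ (q - 1)) = q * a * b ^ (q - 1) := by field_simp
      linarith
    · rcases ha.eq_or_lt with rfl | ha
      · simp [hq0.ne', hq1.ne']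
      · rw [Real.rpow_sub_one (by positivity)]
        field_simp
        ring

/-- Joint convexity and monotonicity of `(a, s) ↦ a ^ q / s ^ (q - 1)`. -/
theorem ratio_rpow_mix_le (hq : 1 < q) {a a' s s' v v' m θ θ' : ℝ} (ha : 0 ≤ a) (ha' : 0 ≤ a')
    (hs : 0 ≤ s) (hs' : 0 ≤ s') (hθ : 0 ≤ θ) (hθ' : 0 ≤ θ')
    (hm : 0 ≤ m) (hle : m ≤ θ * a + θ' * a')
    (h : ratio q (a ^ q) s ≤ (v : EReal)) (h' : ratio q (a' ^ q) s' ≤ (v' : EReal)) :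
    ratio q (m ^ q) (θ * s + θ' * s') ≤ ((θ * v + θ' * v' : ℝ) : EReal) := by
  have hq0 : 0 < q := by linarith
  rw [ratio_rpow_le_iff hq ha hs] at h
  rw [ratio_rpow_le_iff hq ha' hs'] at h'
  rw [ratio_rpow_le_iff hq hm (by positivity)]
  intro b hb
  have h1 := mul_le_mul_of_nonneg_left (h b hb) hθ
  have h2 := mul_le_mul_of_nonneg_left (h' b hb) hθ'
  have h3 := mul_le_mul_of_nonneg_right (mul_le_mul_of_nonneg_left hle hq0.le)
    (Real.rpow_nonneg hb (q - 1))
  linarith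

/-- The half-space with `b = q ^ (1 / (1 - q))`, where `a` has coefficient one and `s` has
coefficient `-constOne q`. The case `s = 0` is included. -/
theorem le_add_constOne_mul (hq : 1 < q) {a s v : ℝ} (ha : 0 ≤ a) (hs : 0 ≤ s)
    (h : ratio q (a ^ q) s ≤ (v : EReal)) : a ≤ v + constOne q * s := by
  have h1 := (ratio_rpow_le_iff hq ha hs).1 h (q ^ (1 / (1 - q)))
    (Real.rpow_nonneg (by linarith) _)
  rw [constOne_eq hq]
  have h2 : q * a * (q ^ (1 / (1 - q))) ^ (q - 1) = a := by
    rw [mul_right_comm, mul_rpow_sub_one_eq_one hq, one_mul]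
  linarith

/-- The optimal `s` in `X ^ (1 / q) = min_s (X / s ^ (q - 1) + C s)`, and the slope there. -/
theorem exists_rpow_eq_div_add (hq : 1 < q) {X : ℝ} (hX : 0 < X) :
    ∃ s, 0 < s ∧ 1 / s ^ (q - 1) = 1 / q * X ^ (1 / q - 1) ∧
      X / s ^ (q - 1) + constOne q * s = X ^ (1 / q) := by
  have hq0 : 0 < q := by linarith
  set β := q ^ (1 / (1 - q)) with hβ
  have hβ0 : 0 < β := Real.rpow_pos_of_pos hq0 _
  have hβ1 : q * β ^ (q - 1) = 1 := mul_rpow_sub_one_eq_one hq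
  have hXq : 0 < X ^ (1 / q) := Real.rpow_pos_of_pos hX _
  have h1 : (X ^ (1 / q) / β) ^ (q - 1) = q * X ^ (1 - 1 / q) := by
    rw [Real.div_rpow hXq.le hβ0.le, ← Real.rpow_mul hX.le,
      show 1 / q * (q - 1) = 1 - 1 / q by field_simp, div_eq_iff (by positivity)]
    linear_combination -X ^ (1 - 1 / q) * hβ1
  have h2 : X ^ (1 / q) * X ^ (1 - 1 / q) = X := by
    rw [← Real.rpow_add hX]
    simp
  have h3 : X ^ (1 / q - 1) * X ^ (1 - 1 / q) = 1 := by
    rw [← Real.rpow_add hX]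
    simp
  have hX1 : 0 < X ^ (1 - 1 / q) := Real.rpow_pos_of_pos hX _
  refine ⟨X ^ (1 / q) / β, by positivity, ?_, ?_⟩
  · rw [h1, eq_inv_of_mul_eq_one_left h3, one_div, one_div, mul_inv]
  · have h4 : constOne q * (X ^ (1 / q) / β) = (q - 1) * β ^ (q - 1) * X ^ (1 / q) := by
      rw [constOne_eq hq, ← hβ, Real.rpow_sub_one hβ0.ne']
      field_simp
    have h5 : X / (q * X ^ (1 - 1 / q)) = X ^ (1 / q) / q := by
      rw [div_eq_div_iff (by positivity) hq0.ne']
      linear_combination -q * h2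
    have h6 : β ^ (q - 1) = 1 / q := by field_simp; linarith
    rw [h1, h4, h5, h6]
    field_simp
    ring

theorem ratio_sum_le {ι : Type*} (I : Finset ι) {p A v : ι → ℝ} {s : ℝ} (hp : ∀ i, 0 ≤ p i)
    (h : ∀ i, ratio q (A i) s ≤ (v i : EReal)) :
    ratio q (∑ i ∈ I, p i * A i) s ≤ ((∑ i ∈ I, p i * v i : ℝ) : EReal) := by
  by_cases hs : s = 0
  · have h1 : ∀ i, A i = 0 ∧ 0 ≤ v i := by
      intro i
      have := h i
      rw [ratio, if_pos hs] at this
      by_cases hA : A i = 0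
      · rw [if_pos hA] at this
        exact ⟨hA, by exact_mod_cast this⟩
      · rw [if_neg hA] at this
        exact absurd this (not_le.2 (EReal.coe_lt_top _))
    rw [ratio, if_pos hs, if_pos (Finset.sum_eq_zero fun i _ => by rw [(h1 i).1, mul_zero])]
    exact_mod_cast Finset.sum_nonneg fun i _ => mul_nonneg (hp i) (h1 i).2
  · simp only [ratio, if_neg hs, EReal.coe_le_coe_iff] at h ⊢
    rw [Finset.sum_div]
    refine Finset.sum_le_sum fun i _ => ?_
    rw [mul_div_assoc]
    exact mul_le_mul_of_nonneg_left (h i) (hp i)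

/-- A convex set in the quadrant on which `x ^ (1 / q) + y ^ (1 / q)` is bounded has a tangent
majorant with almost the same bound. -/
theorem exists_tangent_majorant (hq : 1 < q) {K : Set (ℝ × ℝ)} (hK : Convex ℝ K)
    (hKne : K.Nonempty) (hK0 : ∀ z ∈ K, 0 ≤ z.1 ∧ 0 ≤ z.2) {R R' : ℝ}
    (hR : ∀ z ∈ K, z.1 ^ (1 / q) + z.2 ^ (1 / q) ≤ R) (hRR' : R < R') :
    ∃ s₁ s₂, 0 < s₁ ∧ 0 < s₂ ∧ ∀ z ∈ K,
      z.1 / s₁ ^ (q - 1) + z.2 / s₂ ^ (q - 1) + constOne q * s₁ + constOne q * s₂ ≤ R' := by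
  have hq0 : 0 < q := by linarith
  have hq1 : 0 ≤ 1 / q := by positivity
  set B : Set (ℝ × ℝ) := ({z | 0 ≤ z.1} ∩ {z | 0 ≤ z.2}) ∩
    {z | z.1 ^ (1 / q) + z.2 ^ (1 / q) ≤ R} with hB
  have hBclosed : IsClosed B := by
    refine ((isClosed_le continuous_const continuous_fst).inter
      (isClosed_le continuous_const continuous_snd)).inter (isClosed_le ?_ continuous_const)
    exact (continuous_fst.rpow_const fun _ => Or.inr hq1).add
      (continuous_snd.rpow_const fun _ => Or.inr hq1)
  have hKB : closure K ⊆ B := closure_minimal (fun z hz => ⟨hK0 z hz, hR z hz⟩) hBclosed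
  have hroot : ∀ x : ℝ, 0 ≤ x → x ^ (1 / q) ≤ R → x ≤ R ^ q := fun x hx h => by
    have := Real.rpow_le_rpow (Real.rpow_nonneg hx _) h hq0.le
    rwa [← Real.rpow_mul hx, one_div_mul_cancel hq0.ne', Real.rpow_one] at this
  have hBbox : B ⊆ Icc (0, 0) (R ^ q, R ^ q) := by
    rintro z ⟨⟨h1, h2⟩, h3⟩
    simp only [mem_ofPred_eq] at h1 h2 h3
    have h4 := Real.rpow_nonneg h1 (1 / q)
    have h5 := Real.rpow_nonneg h2 (1 / q)
    exact ⟨⟨h1, h2⟩, ⟨hroot _ h1 (by linarith), hroot _ h2 (by linarith)⟩⟩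
  have hcomp : IsCompact (closure K) :=
    isCompact_Icc.of_isClosed_subset isClosed_closure (hKB.trans hBbox)
  -- Shifting both coordinates by `η` keeps the gradient finite on the axes; by subadditivity of the
  -- root it raises the bound by at most `2 * η ^ (1 / q) = R' - R`.
  set η := ((R' - R) / 2) ^ q with hη
  have hη0 : 0 < η := Real.rpow_pos_of_pos (by linarith) _
  have hηq : η ^ (1 / q) = (R' - R) / 2 := by
    rw [hη, ← Real.rpow_mul (by linarith), mul_one_div_cancel hq0.ne', Real.rpow_one]
  set F : ℝ × ℝ → ℝ := fun z => (z.1 + η) ^ (1 / q) + (z.2 + η) ^ (1 / q) with hF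
  have hFcont : Continuous F :=
    ((continuous_fst.add continuous_const).rpow_const fun _ => Or.inr hq1).add
      ((continuous_snd.add continuous_const).rpow_const fun _ => Or.inr hq1)
  obtain ⟨z₀, hz₀, hmax⟩ := hcomp.exists_isMaxOn hKne.closure hFcont.continuousOn
  obtain ⟨⟨hx0, hy0⟩, hz₀R⟩ := hKB hz₀
  simp only [mem_ofPred_eq] at hx0 hy0 hz₀R
  have hX : 0 < z₀.1 + η := by linarith
  have hY : 0 < z₀.2 + η := by linarith
  obtain ⟨s₁, hs₁, hg₁, he₁⟩ := exists_rpow_eq_div_add hq hX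
  obtain ⟨s₂, hs₂, hg₂, he₂⟩ := exists_rpow_eq_div_add hq hY
  refine ⟨s₁, s₂, hs₁, hs₂, fun z hz => ?_⟩
  have hderiv : HasFDerivAt F
      ((1 / q * (z₀.1 + η) ^ (1 / q - 1)) • ContinuousLinearMap.fst ℝ ℝ ℝ +
        (1 / q * (z₀.2 + η) ^ (1 / q - 1)) • ContinuousLinearMap.snd ℝ ℝ ℝ) z₀ :=
    ((hasFDerivAt_fst.add_const η).rpow_const (Or.inl hX.ne')).add
      ((hasFDerivAt_snd.add_const η).rpow_const (Or.inl hY.ne'))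
  -- First-order condition at the maximizer `z₀`; the partial derivatives there are `1 / s₁ ^ (q -
  -- 1)` and `1 / s₂ ^ (q - 1)`.
  have hfirst := (hmax.localize).hasFDerivWithinAt_nonpos hderiv.hasFDerivWithinAt
    (sub_mem_posTangentConeAt_of_segment_subset
      (hK.closure.segment_subset hz₀ (subset_closure hz)))
  simp only [_root_.add_apply, _root_.smul_apply,
    ContinuousLinearMap.coe_fst', ContinuousLinearMap.coe_snd', Prod.fst_sub, Prod.snd_sub,
    smul_eq_mul, ← hg₁, ← hg₂] at hfirst
  have hFle : F z₀ ≤ R' := by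
    have h1 := Real.rpow_add_le_add_rpow hx0 hη0.le hq1 ((div_le_one hq0).2 hq.le)
    have h2 := Real.rpow_add_le_add_rpow hy0 hη0.le hq1 ((div_le_one hq0).2 hq.le)
    simp only [hF]
    linarith
  simp only [hF, ← he₁, ← he₂] at hFle
  have h1 : 0 < η * (1 / s₁ ^ (q - 1)) := by positivity
  have h2 : 0 < η * (1 / s₂ ^ (q - 1)) := by positivity
  rw [div_eq_mul_one_div _ (s₁ ^ (q - 1)), div_eq_mul_one_div _ (s₂ ^ (q - 1))] at hFle ⊢
  linarith

end Scalar

/-! ### The perspective term and the elimination of the second parameter. -/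

section Perspective

variable {E : Type*} [NormedAddCommGroup E] [NormedSpace ℝ E] {q C : ℝ}

/-- This brings the perspective term under the half-space description of `ratio`, with the exponent
conjugate to `q`. -/
theorem perspective_eq_ratio {r : ℝ} (hr : 1 < r) {w : ℝ} (hw : 0 ≤ w) (α : StrongDual ℝ E) :
    perspective r w α = ratio r (‖α‖ ^ r) w := by
  have hr0 : 0 < r := by linarith
  rcases hw.eq_or_lt with rfl | hw
  · by_cases hα : α = 0
    · simp [perspective, ratio, hα, hr0.ne']
    · simp [perspective, ratio, hα, Real.rpow_eq_zero (norm_nonneg α) hr0.ne']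
  · rw [perspective, if_neg hw.ne', ratio_of_pos hw, div_rpow_sub_one_eq (norm_nonneg α) hw,
      norm_smul, norm_inv, Real.norm_of_nonneg hw.le, inv_mul_eq_div]

theorem one_lt_conj (hq : 1 < q) : 1 < q / (q - 1) := by
  rw [lt_div_iff₀ (by linarith)]
  linarith

theorem mul_rpow_le_of_perspective_le (hq : 1 < q) (hC : 0 < C) {α : StrongDual ℝ E}
    {w π δ : ℝ} (hw : 0 ≤ w) (hδ : 0 ≤ δ)
    (h : perspective (q / (q - 1)) w α ≤ (π : EReal)) :
    C * δ ^ (1 / q) * ‖α‖ ≤ w * δ + constTwo q C * π := by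
  have hq0 : 0 < q := by linarith
  have hq1 : 0 < q - 1 := by linarith
  have hr := one_lt_conj hq
  rw [perspective_eq_ratio hr hw, ratio_rpow_le_iff hr (norm_nonneg α) hw] at h
  set β := q ^ (1 / (1 - q)) with hβ
  have hβ0 : 0 < β := Real.rpow_pos_of_pos hq0 _
  have hβ1 : q * β ^ (q - 1) = 1 := mul_rpow_sub_one_eq_one hq
  set d := δ ^ (1 / q) with hd
  have hd0 : 0 ≤ d := Real.rpow_nonneg hδ _
  have hdq : d ^ q = δ := by
    rw [hd, ← Real.rpow_mul hδ, one_div_mul_cancel hq0.ne', Real.rpow_one]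
  have hr1 : q / (q - 1) - 1 = 1 / (q - 1) := by field_simp; ring
  have hCr : C ^ (q / (q - 1)) = C * C ^ (1 / (q - 1)) := by
    rw [← Real.rpow_one_add' hC.le (by positivity)]
    congr 1
    linarith
  have hb1 : ((d / β) ^ (q - 1) / C) ^ (q / (q - 1) - 1) = d / β / C ^ (1 / (q - 1)) := by
    rw [hr1, Real.div_rpow (by positivity) hC.le, ← Real.rpow_mul (by positivity),
      mul_one_div_cancel hq1.ne', Real.rpow_one]
  have hb2 : ((d / β) ^ (q - 1) / C) ^ (q / (q - 1)) = δ / β ^ q / C ^ (q / (q - 1)) := by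
    rw [Real.div_rpow (by positivity) hC.le, ← Real.rpow_mul (by positivity),
      mul_div_cancel₀ _ hq1.ne', Real.div_rpow hd0 hβ0.le, hdq]
  -- The half-space for which, after multiplication by `constTwo q C`, `w` has coefficient `-δ` and
  -- `‖α‖` has coefficient `C * δ ^ (1 / q)`.
  have h1 := h ((d / β) ^ (q - 1) / C) (by positivity)
  rw [hb1, hb2, hr1] at h1
  have h2 := mul_le_mul_of_nonneg_left h1 (constTwo_pos hq hC).le
  have hC1 : 0 < C ^ (1 / (q - 1)) := Real.rpow_pos_of_pos hC _
  have h3 : constTwo q C * (q / (q - 1) * ‖α‖ * (d / β / C ^ (1 / (q - 1))) -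
      1 / (q - 1) * w * (δ / β ^ q / C ^ (q / (q - 1)))) =
      C * d * ‖α‖ * (q * β ^ (q - 1)) - w * δ := by
    have hβq : β ^ q = β * β ^ (q - 1) := by
      rw [Real.rpow_sub_one hβ0.ne']
      field_simp
    have hβp : 0 < β ^ (q - 1) := Real.rpow_pos_of_pos hβ0 _
    rw [constTwo_eq, constOne_eq hq, ← hβ, hCr, hβq]
    field_simp
  rw [h3, hβ1] at h2
  linarith

/-- With this `w` the weighted perspective term equals `constOne q * s` for `α ≠ 0` and is zero for
`α = 0`. Thus `v_{N+1}` encodes the second parameter of the tangent majorant. -/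
theorem exists_perspective_le (hq : 1 < q) (hC : 0 < C) (α : StrongDual ℝ E) {s : ℝ}
    (hs : 0 < s) :
    ∃ π : ℝ, perspective (q / (q - 1)) ((C * ‖α‖) ^ q / s ^ (q - 1)) α ≤ (π : EReal) ∧
      constTwo q C * π ≤ constOne q * s := by
  have hq0 : 0 < q := by linarith
  have hq1 : 0 < q - 1 := by linarith
  have hr := one_lt_conj hq
  rcases eq_or_ne α 0 with rfl | hα
  · refine ⟨0, ?_, ?_⟩
    · rw [norm_zero, mul_zero, Real.zero_rpow hq0.ne', zero_div, perspective, if_pos rfl,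
        if_pos rfl, EReal.coe_zero]
    · rw [mul_zero]
      exact (mul_pos (constOne_pos hq) hs).le
  · have hκ : 0 < C * ‖α‖ := mul_pos hC (norm_pos_iff.2 hα)
    have hw : 0 < (C * ‖α‖) ^ q / s ^ (q - 1) := by positivity
    rw [perspective_eq_ratio hr hw.le, ratio_of_pos hw]
    refine ⟨_, le_rfl, le_of_eq ?_⟩
    have h1 : ((C * ‖α‖) ^ q / s ^ (q - 1)) ^ (q / (q - 1) - 1) =
        (C * ‖α‖) ^ (q / (q - 1)) / s := by
      rw [show q / (q - 1) - 1 = 1 / (q - 1) by field_simp; ring,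
        Real.div_rpow (by positivity) (by positivity), ← Real.rpow_mul hκ.le,
        ← Real.rpow_mul hs.le, mul_one_div_cancel hq1.ne', Real.rpow_one, mul_one_div]
    have h2 : 0 < (C * ‖α‖) ^ (q / (q - 1)) := Real.rpow_pos_of_pos hκ _
    rw [h1, constTwo_eq]
    rw [Real.mul_rpow hC.le (norm_nonneg α)] at h2 ⊢
    have h3 : C ^ (q / (q - 1)) ≠ 0 := (Real.rpow_pos_of_pos hC _).ne'
    have h4 : ‖α‖ ^ (q / (q - 1)) ≠ 0 := (Real.rpow_pos_of_pos (norm_pos_iff.2 hα) _).ne'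
    field_simp

end Perspective

/-! ### Convexity and optimal value of the conic program. -/

section Program

theorem coe_toENNReal_rpow_le_coe_iff {q : ℝ} (hq : 0 < q) {B : EReal} {c : ℝ} :
    ((B.toENNReal ^ q : ℝ≥0∞) : EReal) ≤ (c : EReal) ↔
      0 ≤ c ∧ B ≤ ((c ^ (1 / q) : ℝ) : EReal) := by
  by_cases hc : 0 ≤ c
  · have hcq : 0 ≤ c ^ (1 / q) := Real.rpow_nonneg hc _
    have h1 : ∀ d : ℝ, 0 ≤ d → (d : EReal) = ((ENNReal.ofReal d : ℝ≥0∞) : EReal) := fun d hd => by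
      rw [EReal.coe_ennreal_ofReal, max_eq_left hd]
    have h2 : B ≤ ((c ^ (1 / q) : ℝ) : EReal) ↔ B.toENNReal ≤ ENNReal.ofReal (c ^ (1 / q)) := by
      rw [← EReal.coe_ennreal_le_coe_ennreal_iff, ← h1 _ hcq, EReal.coe_toENNReal_eq_max,
        max_le_iff]
      exact ⟨fun h => ⟨by exact_mod_cast hcq, h⟩, fun h => h.2⟩
    rw [h2, h1 c hc, EReal.coe_ennreal_le_coe_ennreal_iff,
      ← ENNReal.ofReal_rpow_of_nonneg hc (by positivity), one_div, ENNReal.le_rpow_inv_iff hq]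
    exact ⟨fun h => ⟨hc, h⟩, fun h => h.2⟩
  · refine ⟨fun h => absurd ?_ hc, fun h => absurd h.1 hc⟩
    exact_mod_cast (EReal.coe_ennreal_nonneg _).trans h

theorem ereal_add_coe_le_coe_iff {σ : EReal} {r d : ℝ} :
    σ + (r : EReal) ≤ (d : EReal) ↔ σ ≤ ((d - r : ℝ) : EReal) := by
  induction σ using EReal.rec with
  | bot => simp
  | top => simp only [EReal.top_add_coe, top_le_iff, EReal.coe_ne_top]
  | coe x =>
    rw [← EReal.coe_add, EReal.coe_le_coe_iff, EReal.coe_le_coe_iff, le_sub_iff_add_le]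

variable {E : Type*} [NormedAddCommGroup E] [NormedSpace ℝ E] {N : ℕ} {q C : ℝ}
  {V : Set ((Fin N → ℝ) × ℝ)} {A : Set (StrongDual ℝ E)} {y : Fin N → E} {ℓbar : ℝ → ℝ}

/-- The sublevel sets of the objective of the conic program. -/
theorem objectivePow_le_iff (hq : 1 < q) (hC : 0 < C) (hne : (Vplus V).Nonempty)
    {x : StrongDual ℝ E × ℝ × ℝ × ((Fin N → ℝ) × ℝ)} {c : ℝ} :
    objectivePow q C V x ≤ (c : EReal) ↔ 0 ≤ c ∧ ∃ π : ℝ,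
      perspective (q / (q - 1)) x.2.2.2.2 x.1 ≤ (π : EReal) ∧
      ∀ z ∈ Vplus V, ∑ i, x.2.2.2.1 i * z.1 i + x.2.2.2.2 * z.2 + constOne q * x.2.2.1 +
        constTwo q C * π ≤ c ^ (1 / q) := by
  have hC2 := constTwo_pos hq hC
  rw [objectivePow, coe_toENNReal_rpow_le_coe_iff (by linarith)]
  refine and_congr_right fun _ => ?_
  have hcases : perspective (q / (q - 1)) x.2.2.2.2 x.1 = ⊤ ∨
      ∃ π : ℝ, perspective (q / (q - 1)) x.2.2.2.2 x.1 = (π : EReal) := by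
    unfold perspective
    split_ifs
    · exact Or.inr ⟨0, rfl⟩
    · exact Or.inl rfl
    · exact Or.inr ⟨_, rfl⟩
  rcases hcases with h | ⟨π, h⟩
  · rw [h, EReal.coe_mul_top_of_pos hC2]
    -- Nonemptiness keeps the support function away from `⊥`, which would otherwise absorb the
    -- infinite perspective term.
    obtain ⟨z, hz⟩ := hne
    have hbot : supportFn (Vplus V) x.2.2.2 + ((constOne q * x.2.2.1 : ℝ) : EReal) ≠ ⊥ := by
      refine EReal.add_ne_bot_iff.2 ⟨?_, EReal.coe_ne_bot _⟩
      exact ne_bot_of_le_ne_bot (EReal.coe_ne_bot _) (le_iSup₂_of_le z hz le_rfl)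
    rw [EReal.add_top_of_ne_bot hbot]
    simp
  · rw [h, ← EReal.coe_mul, ereal_add_coe_le_coe_iff, ereal_add_coe_le_coe_iff,
      supportFn_le_coe_iff]
    constructor
    · exact fun h' => ⟨π, le_rfl, fun z hz => by linarith [h' z hz]⟩
    · rintro ⟨π', hπ', h'⟩ z hz
      have h1 := mul_le_mul_of_nonneg_left (EReal.coe_le_coe_iff.1 hπ') hC2.le
      linarith [h' z hz]

/-- Taking `q`-th roots turns the epigraph into `base ≤ c ^ (1 / q)` with `c ≥ 0`, which is convex
because the base is convex and the root is concave. -/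
theorem isConvexProgram_feasiblePow (hq : 1 < q) (hC : 0 < C) (hℓ : IsDistLike ℓbar)
    (hne : (Vplus V).Nonempty) (hA : Convex ℝ A) :
    IsConvexProgram (feasiblePow q A y (fun z t => (C * ℓbar (z - t)) ^ q))
      (objectivePow q C V) := by
  have hr := one_lt_conj hq
  have hS : Convex ℝ (feasiblePow q A y (fun z t => (C * ℓbar (z - t)) ^ q)) := by
    rintro ⟨α, t, s, v, w⟩ ⟨hα, hs, hv, hw⟩ ⟨α', t', s', v', w'⟩ ⟨hα', hs', hv', hw'⟩ a b ha hb hab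
    refine ⟨hA hα hα' ha hb hab, ?_, fun i => ?_, ?_⟩
    · exact add_nonneg (mul_nonneg ha hs) (mul_nonneg hb hs')
    · refine ratio_rpow_mix_le hq (mul_nonneg hC.le (hℓ.nonneg _))
        (mul_nonneg hC.le (hℓ.nonneg _)) hs hs' ha hb (mul_nonneg hC.le (hℓ.nonneg _)) ?_
        (hv i) (hv' i)
      have := mul_le_mul_of_nonneg_left
        (hℓ.apply_sub_mix_le (α (y i)) (α' (y i)) t t' ha hb hab) hC.le
      simp only [Prod.smul_mk, Prod.mk_add_mk, _root_.add_apply, _root_.smul_apply, smul_eq_mul]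
      linarith
    · exact add_nonneg (mul_nonneg ha hw) (mul_nonneg hb hw')
  refine ⟨hS, ?_⟩
  rintro ⟨x, c⟩ ⟨hx, hc⟩ ⟨x', c'⟩ ⟨hx', hc'⟩ a b ha hb hab
  refine ⟨hS hx hx' ha hb hab, ?_⟩
  simp only [objectivePow_le_iff hq hC hne] at hc hc' ⊢
  obtain ⟨hc0, π, hπ, hc⟩ := hc
  obtain ⟨hc0', π', hπ', hc'⟩ := hc'
  rw [perspective_eq_ratio hr hx.2.2.2] at hπ
  rw [perspective_eq_ratio hr hx'.2.2.2] at hπ'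
  refine ⟨add_nonneg (mul_nonneg ha hc0) (mul_nonneg hb hc0'), a * π + b * π', ?_, fun z hz => ?_⟩
  · change perspective _ (a • x + b • x').2.2.2.2 (a • x + b • x').1 ≤ _
    rw [perspective_eq_ratio hr (hS hx hx' ha hb hab).2.2.2]
    refine ratio_rpow_mix_le hr (norm_nonneg _) (norm_nonneg _) hx.2.2.2 hx'.2.2.2 ha hb
      (norm_nonneg _) ?_ hπ hπ'
    refine (norm_add_le (a • x.1) (b • x'.1)).trans_eq ?_
    rw [norm_smul, norm_smul, Real.norm_of_nonneg ha,
      Real.norm_of_nonneg hb]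
  · have hconc := (Real.concaveOn_rpow (p := 1 / q) (by positivity)
      ((div_le_one (by linarith)).2 hq.le)).2 (mem_Ici.2 hc0) (mem_Ici.2 hc0') ha hb hab
    have h1 := sum_mul_mix x.2.2.2 x'.2.2.2 z a b
    have h2 := mul_le_mul_of_nonneg_left (hc z hz) ha
    have h3 := mul_le_mul_of_nonneg_left (hc' z hz) hb
    simp only [Prod.smul_mk, Prod.mk_add_mk, Prod.snd_add, Prod.smul_snd, Prod.fst_add,
      Prod.smul_fst, smul_eq_mul] at hconc h1 ⊢
    rw [h1]
    linarith

theorem convex_Vplus (hV : Convex ℝ V) : Convex ℝ (Vplus V) := by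
  rintro x ⟨hx, hx2⟩ x' ⟨hx', hx2'⟩ a b ha hb hab
  exact ⟨hV hx hx' ha hb hab, add_nonneg (mul_nonneg ha hx2) (mul_nonneg hb hx2')⟩

/-- Weak duality at each `(p, δ)`: the averaged ratio constraints bound the root of the expected
loss, and the perspective term bounds the transport term. -/
theorem robustPow_le_objectivePow (hq : 1 < q) (hC : 0 < C) (hℓ : ∀ x, 0 ≤ ℓbar x)
    (hp : ∀ x ∈ V, x.1 ∈ stdSimplex ℝ (Fin N)) (hne : (Vplus V).Nonempty)
    {x : StrongDual ℝ E × ℝ × ℝ × ((Fin N → ℝ) × ℝ)}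
    (hx : x ∈ feasiblePow q A y (fun z t => (C * ℓbar (z - t)) ^ q)) :
    robustPow q C y V (fun z t => (C * ℓbar (z - t)) ^ q) x.1 x.2.1 ≤ objectivePow q C V x := by
  have hq0 : 0 < q := by linarith
  refine EReal.le_of_forall_lt_iff_le.1 fun c hc => ?_
  obtain ⟨hc0, π, hπ, hc⟩ := (objectivePow_le_iff hq hC hne).1 hc.le
  refine iSup₂_le fun z hz => EReal.coe_le_coe_iff.2 ?_
  have hz0 := (hp z hz.1).1
  have hS : 0 ≤ ∑ i, z.1 i * (C * ℓbar (x.1 (y i) - x.2.1)) ^ q :=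
    Finset.sum_nonneg fun i _ =>
      mul_nonneg (hz0 i) (Real.rpow_nonneg (mul_nonneg hC.le (hℓ _)) _)
  have h1 := ratio_sum_le Finset.univ hz0 hx.2.2.1
  have h2 : (∑ i, z.1 i * (C * ℓbar (x.1 (y i) - x.2.1)) ^ q) ^ (1 / q) ≤
      ∑ i, z.1 i * x.2.2.2.1 i + constOne q * x.2.2.1 := by
    refine le_add_constOne_mul hq (Real.rpow_nonneg hS _) hx.2.1 ?_
    rwa [← Real.rpow_mul hS, one_div_mul_cancel hq0.ne', Real.rpow_one]
  have h3 := mul_rpow_le_of_perspective_le hq hC hx.2.2.2 hz.2 hπ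
  have h4 := hc z hz
  simp only [mul_comm (x.2.2.2.1 _)] at h4
  have hz2 := hz.2
  calc _ ≤ (c ^ (1 / q)) ^ q := by
        refine Real.rpow_le_rpow (by positivity) ?_ hq0.le
        linarith
    _ = c := by rw [← Real.rpow_mul hc0, one_div_mul_cancel hq0.ne', Real.rpow_one]

/-- Strong duality: a linear map sends `Vplus V` to a convex subset of the quadrant, whose tangent
majorant supplies `s = s₁` and, through `s₂`, the value of `v_{N+1}`. -/
theorem exists_feasiblePow_objectivePow_le (hq : 1 < q) (hC : 0 < C) (hℓ : ∀ x, 0 ≤ ℓbar x)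
    (hV : Convex ℝ V) (hp : ∀ x ∈ V, x.1 ∈ stdSimplex ℝ (Fin N)) (hne : (Vplus V).Nonempty)
    {α : StrongDual ℝ E} (hα : α ∈ A) (t : ℝ) {c : ℝ}
    (hc : robustPow q C y V (fun z t => (C * ℓbar (z - t)) ^ q) α t < (c : EReal)) :
    ∃ x ∈ feasiblePow q A y (fun z t => (C * ℓbar (z - t)) ^ q),
      objectivePow q C V x ≤ (c : EReal) := by
  have hq0 : 0 < q := by linarith
  -- The gap between `M` and `c` is the slack that the tangent majorant requires.
  obtain ⟨M, hM, hMc⟩ := EReal.lt_iff_exists_real_btwn.1 hc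
  replace hMc : M < c := by exact_mod_cast hMc
  have ha : ∀ i, 0 ≤ (C * ℓbar (α (y i) - t)) ^ q := fun i =>
    Real.rpow_nonneg (mul_nonneg hC.le (hℓ _)) _
  have hS : ∀ z ∈ Vplus V, 0 ≤ ∑ i, z.1 i * (C * ℓbar (α (y i) - t)) ^ q := fun z hz =>
    Finset.sum_nonneg fun i _ => mul_nonneg ((hp z hz.1).1 i) (ha i)
  have hF0 : ∀ z ∈ Vplus V, 0 ≤ (∑ i, z.1 i * (C * ℓbar (α (y i) - t)) ^ q) ^ (1 / q) +
      C * z.2 ^ (1 / q) * ‖α‖ := fun z hz => by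
    have h1 := hS z hz
    have h2 := hz.2
    positivity
  have hFM : ∀ z ∈ Vplus V, ((∑ i, z.1 i * (C * ℓbar (α (y i) - t)) ^ q) ^ (1 / q) +
      C * z.2 ^ (1 / q) * ‖α‖) ^ q ≤ M := fun z hz =>
    EReal.coe_le_coe_iff.1 ((le_iSup₂_of_le z hz le_rfl).trans hM.le)
  have hM0 : 0 ≤ M := by
    obtain ⟨z, hz⟩ := hne
    exact (Real.rpow_nonneg (hF0 z hz) q).trans (hFM z hz)
  set G : (Fin N → ℝ) × ℝ → ℝ × ℝ := fun z =>
    (∑ i, z.1 i * (C * ℓbar (α (y i) - t)) ^ q, (C * ‖α‖) ^ q * z.2) with hG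
  have hGlin : IsLinearMap ℝ G := by
    constructor
    · intro z z'
      simp only [hG, Prod.fst_add, Pi.add_apply, add_mul, Finset.sum_add_distrib, Prod.snd_add,
        mul_add, Prod.mk_add_mk]
    · intro b z
      simp only [hG, Prod.smul_fst, Pi.smul_apply, smul_eq_mul, mul_assoc, Finset.mul_sum,
        Prod.smul_snd, Prod.smul_mk]
      congr 1
      ring
  obtain ⟨s₁, s₂, hs₁, hs₂, hs⟩ := exists_tangent_majorant hq
    ((convex_Vplus hV).is_linear_image hGlin) (hne.image G) (R := M ^ (1 / q))
    (R' := c ^ (1 / q)) (by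
      rintro _ ⟨z, hz, rfl⟩
      exact ⟨hS z hz, mul_nonneg (by positivity) hz.2⟩) (by
      rintro _ ⟨z, hz, rfl⟩
      have h1 := Real.rpow_le_rpow (Real.rpow_nonneg (hF0 z hz) q) (hFM z hz)
        (one_div_nonneg.2 hq0.le)
      rw [← Real.rpow_mul (hF0 z hz), mul_one_div_cancel hq0.ne', Real.rpow_one] at h1
      simp only [hG]
      rw [Real.mul_rpow (by positivity) hz.2, ← Real.rpow_mul (by positivity),
        mul_one_div_cancel hq0.ne', Real.rpow_one]
      linarith) (Real.rpow_lt_rpow hM0 hMc (by positivity))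
  obtain ⟨π, hπ, hπle⟩ := exists_perspective_le hq hC α hs₂
  refine ⟨(α, t, s₁, fun i => (C * ℓbar (α (y i) - t)) ^ q / s₁ ^ (q - 1),
    (C * ‖α‖) ^ q / s₂ ^ (q - 1)), ⟨hα, hs₁.le, fun i => ?_, ?_⟩, ?_⟩
  · exact (ratio_of_pos hs₁).le
  · exact div_nonneg (by positivity) (by positivity)
  · refine (objectivePow_le_iff hq hC hne).2 ⟨hM0.trans hMc.le, π, hπ, fun z hz => ?_⟩
    have h1 := hs _ ⟨z, hz, rfl⟩
    have h2 : ∑ i, (C * ℓbar (α (y i) - t)) ^ q / s₁ ^ (q - 1) * z.1 i =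
        (G z).1 / s₁ ^ (q - 1) := by
      simp only [hG, Finset.sum_div]
      exact Finset.sum_congr rfl fun i _ => by ring
    have h3 : (C * ‖α‖) ^ q / s₂ ^ (q - 1) * z.2 = (G z).2 / s₂ ^ (q - 1) := by
      simp only [hG]
      ring
    simp only
    rw [h2, h3]
    linarith

theorem iInf_robustPow_eq_iInf_feasiblePow (hq : 1 < q) (hC : 0 < C) (hℓ : ∀ x, 0 ≤ ℓbar x)
    (hV : Convex ℝ V) (hp : ∀ x ∈ V, x.1 ∈ stdSimplex ℝ (Fin N)) (hne : (Vplus V).Nonempty) :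
    (⨅ α ∈ A, ⨅ t, robustPow q C y V (fun z t => (C * ℓbar (z - t)) ^ q) α t) =
      ⨅ x ∈ feasiblePow q A y (fun z t => (C * ℓbar (z - t)) ^ q), objectivePow q C V x := by
  refine le_antisymm (le_iInf₂ fun x hx => ?_) (le_iInf₂ fun α hα => le_iInf fun t => ?_)
  · exact (iInf₂_le x.1 hx.1).trans
      ((iInf_le _ x.2.1).trans (robustPow_le_objectivePow hq hC hℓ hp hne hx))
  · refine EReal.le_of_forall_lt_iff_le.1 fun c hc => ?_
    obtain ⟨x, hx, hxc⟩ := exists_feasiblePow_objectivePow_le hq hC hℓ hV hp hne hα t hc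
    exact (iInf₂_le x hx).trans hxc

end Program

end UnionBall

theorem mainTheorem6 {E : Type*} [NormedAddCommGroup E] [NormedSpace ℝ E] [FiniteDimensional ℝ E]
    [MeasurableSpace E] [BorelSpace E] (N : ℕ) (y : Fin N → E)
    (V : Set ((Fin N → ℝ) × ℝ)) (hV : Convex ℝ V) (hp : ∀ x ∈ V, x.1 ∈ stdSimplex ℝ (Fin N))
    (A : Set (StrongDual ℝ E)) :
    -- ground cost `‖y₁ - y₂‖`
    (∀ (k : ℕ) (ℓ : ℝ → (Fin k → ℝ) → ℝ),
      ConvexOn ℝ Set.univ (fun x : ℝ × (Fin k → ℝ) => ℓ x.1 x.2) →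
      (∀ z, UnionBall.LevelBounded (ℓ z)) →
      (∃ K : ℝ≥0, ∀ t, LipschitzWith K fun z => ℓ z t) →
      -- all expectations in the union-ball problem are finite
      (∀ Q ∈ UnionBall.unionBall (fun y₁ y₂ : E => ‖y₁ - y₂‖) y V, ∀ (α : StrongDual ℝ E) t,
        Integrable (fun u => ℓ (α u) t) Q) ∧
      -- the robust optimization problem
      (∀ α : StrongDual ℝ E,
        UnionBall.worstCase (fun y₁ y₂ : E => ‖y₁ - y₂‖) y V ℓ α =
          ⨅ t, UnionBall.robustLip y V ℓ α t) ∧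
      ((⨅ α ∈ A, UnionBall.worstCase (fun y₁ y₂ : E => ‖y₁ - y₂‖) y V ℓ α) =
        (⨅ α ∈ A, ⨅ t, UnionBall.robustLip y V ℓ α t)) ∧
      -- the program
      ((⨅ α ∈ A, UnionBall.worstCase (fun y₁ y₂ : E => ‖y₁ - y₂‖) y V ℓ α) =
        (⨅ x ∈ UnionBall.feasibleLip A y ℓ,
          UnionBall.supportFn (UnionBall.Vplus V) x.2.2)) ∧
      (Convex ℝ A →
        UnionBall.IsConvexProgram (A ×ˢ (Set.univ : Set (Fin k → ℝ)))
          (fun x => UnionBall.robustLip y V ℓ x.1 x.2) ∧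
        UnionBall.IsConvexProgram (UnionBall.feasibleLip A y ℓ)
          (fun x => UnionBall.supportFn (UnionBall.Vplus V) x.2.2))) ∧
    -- ground cost `‖y₁ - y₂‖ ^ q`
    (∀ (q C : ℝ) (ℓbar : ℝ → ℝ) (ℓ : ℝ → ℝ → ℝ), 1 < q → 0 < C →
      ((∃ b₁ b₂ : ℝ, 0 ≤ b₂ ∧ ℓbar = fun x => max (|x - b₁| - b₂) 0) ∨
        (∃ b₁ b₂ : ℝ, 0 < b₂ ∧ ℓbar = fun x => |x - b₁| + b₂)) →
      (ℓ = fun z t => (C * ℓbar (z - t)) ^ q) →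
      -- all expectations in the union-ball problem are finite
      (∀ Q ∈ UnionBall.unionBall (fun y₁ y₂ : E => ‖y₁ - y₂‖ ^ q) y V,
        ∀ (α : StrongDual ℝ E) t, Integrable (fun u => ℓ (α u) t) Q) ∧
      -- the robust optimization problem
      (∀ α : StrongDual ℝ E,
        UnionBall.worstCase (fun y₁ y₂ : E => ‖y₁ - y₂‖ ^ q) y V ℓ α =
          ⨅ t, UnionBall.robustPow q C y V ℓ α t) ∧
      ((⨅ α ∈ A, UnionBall.worstCase (fun y₁ y₂ : E => ‖y₁ - y₂‖ ^ q) y V ℓ α) =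
        (⨅ α ∈ A, ⨅ t, UnionBall.robustPow q C y V ℓ α t)) ∧
      (Convex ℝ A →
        UnionBall.IsConvexProgram (A ×ˢ (Set.univ : Set ℝ))
          (fun x => UnionBall.robustPow q C y V ℓ x.1 x.2)) ∧
      -- the program
      ((UnionBall.Vplus V).Nonempty →
        ((⨅ α ∈ A, UnionBall.worstCase (fun y₁ y₂ : E => ‖y₁ - y₂‖ ^ q) y V ℓ α) =
          (⨅ x ∈ UnionBall.feasiblePow q A y ℓ, UnionBall.objectivePow q C V x)) ∧
        (Convex ℝ A →
          UnionBall.IsConvexProgram (UnionBall.feasiblePow q A y ℓ)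
            (UnionBall.objectivePow q C V)))) := by
  refine ⟨fun k ℓ hconv hlb hlip => ?_, fun q C ℓbar ℓ hq hC hbar hℓ => ?_⟩
  · obtain ⟨hint, hwc, hcvx⟩ := UnionBall.unionBall_lipschitz y V hV hp hconv hlb hlip
    have hval : (⨅ α ∈ A, UnionBall.worstCase (fun y₁ y₂ : E => ‖y₁ - y₂‖) y V ℓ α) =
        (⨅ α ∈ A, ⨅ t, UnionBall.robustLip y V ℓ α t) := by simp only [hwc]
    exact ⟨hint, hwc, hval, hval.trans (UnionBall.iInf_robustLip_eq_iInf_feasibleLip hp),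
      fun hA => ⟨hcvx A hA, UnionBall.isConvexProgram_feasibleLip hA hconv⟩⟩
  · have hdist : UnionBall.IsDistLike ℓbar := by
      rcases hbar with ⟨b₁, b₂, -, rfl⟩ | ⟨b₁, b₂, hb₂, rfl⟩
      · exact UnionBall.isDistLike_max_abs_sub b₁ b₂
      · exact UnionBall.isDistLike_abs_sub_add b₁ hb₂
    subst hℓ
    obtain ⟨hint, hwc, hcvx⟩ := UnionBall.unionBall_rpow hq hC hdist y V hV hp
    have hval : (⨅ α ∈ A, UnionBall.worstCase (fun y₁ y₂ : E => ‖y₁ - y₂‖ ^ q) y V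
          (fun z t => (C * ℓbar (z - t)) ^ q) α) =
        (⨅ α ∈ A, ⨅ t, UnionBall.robustPow q C y V (fun z t => (C * ℓbar (z - t)) ^ q) α t) := by
      simp only [hwc]
    exact ⟨hint, hwc, hval, hcvx A, fun hne =>
      ⟨hval.trans (UnionBall.iInf_robustPow_eq_iInf_feasiblePow hq hC hdist.nonneg hV hp hne),
        fun hA => UnionBall.isConvexProgram_feasiblePow hq hC hdist hne hA⟩⟩
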